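/- Let $r\ge 2$ be an integer, let $M$ be a finite-dimensional (Hausdorff, second countable, not necessarily compact) Riemannian manifold of class $C^r$ without boundary, with a continuous Riemannian metric, and let $d$ be its Riemannian distance. Let $f:M\to M$ be a $C^r$ diffeomorphism and let $\Lambda\subset M$ be a compact set with $f(\Lambda)=\Lambda$ that is transitive: some point of $\Lambda$ has a forward orbit $\{f^n(z):n\ge 0\}$ dense in $\Lambda$. **Partially hyperbolic.** Suppose that $\Lambda$ is partially hyperbolic: $T_\Lambda M=E^s\oplus E^c\oplus E^u$ with continuous $Df$-invariant sub-bundles over $\Lambda$ (each possibly of rank $0$) such that, for some $C>0$ and $0<\lambda<1$, all $x\in\Lambda$ and all $n\ge 0$, $\|Df^n_x v\|\le C\lambda^n\|v\|$ for $v\in E^s(x)$ and $\|Df^{-n}_x v\|\le C\lambda^n\|v\|$ for $v\in E^u(x)$, and such that for all $x\in\Lambda$ $$\|D_xf|_{E^s}\|<\|D_{f(x)}f^{-1}|_{E^c}\|^{-1},\qquad \|D_xf|_{E^c}\|<\|D_{f(x)}f^{-1}|_{E^u}\|^{-1},$$ where an inequality that involves a zero bundle is considered to hold. Suppose that $\dim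 E^c(x)=1$ for all $x\in\Lambda$. **Orientation.** Suppose that $\Lambda$ is $E^c$-orientable and that $f$ preserves the orientation: there are a continuous vector field $X$ on $\Lambda$ with $X(x)\in E^c(x)$ and $\|X(x)\|=1$, and a continuous function $a:\Lambda\to(0,\infty)$ with $Df_x(X(x))=a(x)X(f(x))$ for all $x\in\Lambda$. **Hölder stability.** Suppose that, for some $\alpha>1/2$, $\Lambda$ is $\alpha$-Hölder stable under $C^r$ perturbations: there are a neighbourhood $\mathcal U(f)$ of $f$ in the set of $C^r$ diffeomorphisms of $M$ with the strong $C^r$ topology and a constant $C>0$ such that for every $g\in\mathcal U(f)$ there is a homeomorphism $\varphi$ of $\Lambda$ onto its image in $M$ with $\varphi\circ f|_\Lambda=g\circ\varphi$ and $$\sup_{x\in\Lambda} d(\varphi(x),x)\le C\,d_{C^r}(f,g)^\alpha .$$ Here $d_{C^r}$ is a $C^r$ distance measured in charts, as follows. Choose countably many charts $\chi_i$ of the $C^r$ manifold $M$ with $C^{r+1}$ changes of charts, a locally finite cover of $M$ by compact sets $K_i$ (possibly empty) with $K_i$ in the domain of $\chi_i$, indices $t(i)$ such that $f(K_i)$ lies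 in the domain of $\chi_{t(i)}$, and weights $w_i>0$; then $$d_{C^r}(f,g)=\sup_i\ \max_{k\le r}\ \sup_{y\in\chi_i(K_i)} w_i\,\bigl\|D^k(\chi_{t(i)}\circ f\circ\chi_i^{-1})(y)-D^k(\chi_{t(i)}\circ g\circ\chi_i^{-1})(y)\bigr\|,$$ for $g$ such that $g(K_i)$ lies in the domain of $\chi_{t(i)}$ for all $i$, and $\mathcal U(f)$ consists of the $C^r$ diffeomorphisms $g$ with this property and $d_{C^r}(f,g)<\varepsilon$, for some $\varepsilon>0$. It is enough that the stability holds for one choice of these data. (If $M$ is compact this is the usual $C^r$ topology, and any two such distances made of $C^{r+1}$-compatible charts are Lipschitz equivalent near $f$.) Then $\Lambda$ is a hyperbolic set of $f$: there are continuous $Df$-invariant sub-bundles $F^s,F^u$ over $\Lambda$ with $T_\Lambda M=F^s\oplus F^u$, and constants $C'>0$ and $0<\mu<1$, such that for all $x\in\Lambda$ and $n\ge 0$, $\|Df^n_x v\|\le C'\mu^n\|v\|$ for $v\in F^s(x)$ and $\|Df^{-n}_x v\|\le C'\mu^n\|v\|$ for $v\in F^u(x)$. -/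

import Mathlib

open Set Filter Topology Manifold Bundle
open scoped NNReal ENNReal ContDiff

noncomputable section

namespace HolderStability

section Bundles

variable {E : Type*} [NormedAddCommGroup E] [NormedSpace ℝ E]
  {M : Type*} [TopologicalSpace M] [ChartedSpace E M] [IsManifold 𝓘(ℝ, E) 1 M]

/-- A vector field along `Λ` (its values off `Λ` are irrelevant) is continuous, as a map from `Λ`
to the tangent bundle. -/
def ContinuousField (Λ : Set M) (X : ∀ x : M, TangentSpace 𝓘(ℝ, E) x) : Prop :=
  ContinuousOn (fun x => (⟨x, X x⟩ : TangentBundle 𝓘(ℝ, E) M)) Λ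

/-- A (continuous) vector sub-bundle of `TM` over `Λ`: every point of `Λ` has a neighbourhood
in `Λ` over which the fibres have a frame made of continuous vector fields. The rank is locally
constant, and the fibres off `Λ` are irrelevant. -/
def IsSubbundle (Λ : Set M) (F : ∀ x : M, Submodule ℝ (TangentSpace 𝓘(ℝ, E) x)) : Prop :=
  ∀ x ∈ Λ, ∃ U ∈ 𝓝 x, ∃ (k : ℕ) (v : Fin k → ∀ y : M, TangentSpace 𝓘(ℝ, E) y),
    (∀ j, ContinuousField (U ∩ Λ) (v j)) ∧
    ∀ y ∈ U ∩ Λ, LinearIndependent ℝ (fun j => v j y) ∧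
      Submodule.span ℝ (range fun j => v j y) = F y

end Bundles

section Dynamics

variable {E : Type*} [NormedAddCommGroup E] [NormedSpace ℝ E]
  {M : Type*} [TopologicalSpace M] [ChartedSpace E M] {r : ℕ}

/-- The family of subspaces `F` is invariant under the derivative of `f` over `Λ`. -/
def IsDInvariant (f : M ≃ₘ^r⟮𝓘(ℝ, E), 𝓘(ℝ, E)⟯ M) (Λ : Set M)
    (F : ∀ x : M, Submodule ℝ (TangentSpace 𝓘(ℝ, E) x)) : Prop :=
  ∀ x ∈ Λ, (F x).map (mfderiv 𝓘(ℝ, E) 𝓘(ℝ, E) f x).toLinearMap = F (f x)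

/-- `Λ` is transitive: some point of `Λ` has a forward orbit that is dense in `Λ`. -/
def IsTransitive (f : M ≃ₘ^r⟮𝓘(ℝ, E), 𝓘(ℝ, E)⟯ M) (Λ : Set M) : Prop :=
  ∃ z ∈ Λ, Λ ⊆ closure (range fun n : ℕ => f^[n] z)

end Dynamics

section Splittings

variable {E : Type*} [NormedAddCommGroup E] [NormedSpace ℝ E]
  {M : Type*} [TopologicalSpace M] [ChartedSpace E M] [IsManifold 𝓘(ℝ, E) 1 M]
  [RiemannianBundle (fun x : M => TangentSpace 𝓘(ℝ, E) x)] {r : ℕ}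

/-- Vectors of `F` over `Λ` are (uniformly exponentially) contracted by the forward iterates
of the derivative of `f`. -/
def IsContracted (f : M ≃ₘ^r⟮𝓘(ℝ, E), 𝓘(ℝ, E)⟯ M) (Λ : Set M)
    (F : ∀ x : M, Submodule ℝ (TangentSpace 𝓘(ℝ, E) x)) : Prop :=
  ∃ C > (0 : ℝ), ∃ lam : ℝ, 0 < lam ∧ lam < 1 ∧ ∀ x ∈ Λ, ∀ v ∈ F x, ∀ n : ℕ,
    ‖mfderiv 𝓘(ℝ, E) 𝓘(ℝ, E) (f^[n]) x v‖ ≤ C * lam ^ n * ‖v‖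

/-- `Λ` is a hyperbolic set of `f`: `T_Λ M` is the direct sum of two `Df`-invariant sub-bundles,
one contracted by `f` and the other contracted by the inverse of `f`. -/
def IsHyperbolic (f : M ≃ₘ^r⟮𝓘(ℝ, E), 𝓘(ℝ, E)⟯ M) (Λ : Set M) : Prop :=
  ∃ Es Eu : ∀ x : M, Submodule ℝ (TangentSpace 𝓘(ℝ, E) x),
    IsSubbundle Λ Es ∧ IsSubbundle Λ Eu ∧
    IsDInvariant f Λ Es ∧ IsDInvariant f Λ Eu ∧
    (∀ x ∈ Λ, IsCompl (Es x) (Eu x)) ∧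
    IsContracted f Λ Es ∧ IsContracted f.symm Λ Eu

/-- `F` is dominated by `G` at the points of `Λ`, that is
`‖D_x f|F(x)‖ < ‖D_{f(x)} f⁻¹|G(f(x))‖⁻¹` (the largest stretch of a unit vector of `F(x)` is
smaller than the smallest stretch of a unit vector of `G(x)`). It holds by convention if one of
the two fibres is zero. -/
def IsDominatedBy (f : M ≃ₘ^r⟮𝓘(ℝ, E), 𝓘(ℝ, E)⟯ M) (Λ : Set M)
    (F G : ∀ x : M, Submodule ℝ (TangentSpace 𝓘(ℝ, E) x)) : Prop :=
  ∀ x ∈ Λ, ∀ u ∈ F x, ∀ v ∈ G x, ‖u‖ = 1 → ‖v‖ = 1 →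
    ‖mfderiv 𝓘(ℝ, E) 𝓘(ℝ, E) f x u‖ < ‖mfderiv 𝓘(ℝ, E) 𝓘(ℝ, E) f x v‖

/-- `T_Λ M = Es ⊕ Ec ⊕ Eu` is a partially hyperbolic splitting of `f` over `Λ`. -/
structure IsPartiallyHyperbolic (f : M ≃ₘ^r⟮𝓘(ℝ, E), 𝓘(ℝ, E)⟯ M) (Λ : Set M)
    (Es Ec Eu : ∀ x : M, Submodule ℝ (TangentSpace 𝓘(ℝ, E) x)) : Prop where
  subbundle_s : IsSubbundle Λ Es
  subbundle_c : IsSubbundle Λ Ec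
  subbundle_u : IsSubbundle Λ Eu
  invariant_s : IsDInvariant f Λ Es
  invariant_c : IsDInvariant f Λ Ec
  invariant_u : IsDInvariant f Λ Eu
  disjoint_s_c : ∀ x ∈ Λ, Disjoint (Es x) (Ec x)
  isCompl_sc_u : ∀ x ∈ Λ, IsCompl (Es x ⊔ Ec x) (Eu x)
  contracted_s : IsContracted f Λ Es
  contracted_u : IsContracted f.symm Λ Eu
  dominated_s_c : IsDominatedBy f Λ Es Ec
  dominated_c_u : IsDominatedBy f Λ Ec Eu

/-- `X` is an orientation of the (line) bundle `F` over `Λ`: a continuous vector field on `Λ` of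
unit vectors of `F`. -/
def IsOrientation (Λ : Set M) (F : ∀ x : M, Submodule ℝ (TangentSpace 𝓘(ℝ, E) x))
    (X : ∀ x : M, TangentSpace 𝓘(ℝ, E) x) : Prop :=
  ContinuousField Λ X ∧ ∀ x ∈ Λ, X x ∈ F x ∧ ‖X x‖ = 1

/-- `f` preserves the orientation `X`: `Df_x (X x) = a x • X (f x)` on `Λ`, with `a : Λ → ℝ`
continuous and positive. -/
def PreservesOrientation (f : M ≃ₘ^r⟮𝓘(ℝ, E), 𝓘(ℝ, E)⟯ M) (Λ : Set M)
    (X : ∀ x : M, TangentSpace 𝓘(ℝ, E) x) : Prop :=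
  ∃ a : M → ℝ, ContinuousOn a Λ ∧ ∀ x ∈ Λ, 0 < a x ∧
    mfderiv 𝓘(ℝ, E) 𝓘(ℝ, E) f x (X x) = a x • X (f x)

end Splittings

section CrTopology

variable (E : Type*) [NormedAddCommGroup E] [NormedSpace ℝ E]
  (M : Type*) [TopologicalSpace M] [ChartedSpace E M]

/-- The data by which `C^r` distances and neighbourhoods are measured: charts `χ i` of the `C^r`
manifold `M`, a locally finite cover of `M` by compact sets `K i` with `K i` in the domain of
`χ i`, for each `i` the index `t i` of the chart in which the images of `K i` are read, and
positive weights `w i`. Only finitely many `K i` are non-empty if `M` is compact.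

The changes of charts are asked to be `C^(r+1)`, so that two such distances made of compatible
charts are Lipschitz equivalent when `M` is compact (`C^r` changes of charts only give the same
topology). If `M` is a `C^(r+1)` or a smooth manifold, its charts do. -/
structure CrGauge (r : ℕ) where
  χ : ℕ → OpenPartialHomeomorph M E
  K : ℕ → Set M
  t : ℕ → ℕ
  w : ℕ → ℝ≥0
  χ_mem : ∀ i, χ i ∈ IsManifold.maximalAtlas 𝓘(ℝ, E) r M
  χ_compat : ∀ i j, (χ i).symm.trans (χ j) ∈ contDiffGroupoid ((r + 1 : ℕ) : ℕ∞ω) 𝓘(ℝ, E)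
  isCompact_K : ∀ i, IsCompact (K i)
  K_subset : ∀ i, K i ⊆ (χ i).source
  locallyFinite_K : LocallyFinite K
  iUnion_K : ⋃ i, K i = univ
  w_pos : ∀ i, 0 < w i

variable {E M} {r : ℕ}

namespace CrGauge

/-- `g` maps each `K i` into the domain of the chart in which the image is read. -/
def Adapted (A : CrGauge E M r) (g : M → M) : Prop :=
  ∀ i, MapsTo g (A.K i) (A.χ (A.t i)).source

/-- The map `g` read in the charts of index `i`, near `χ i (K i)`. -/
def local_rep (A : CrGauge E M r) (g : M → M) (i : ℕ) : E → E :=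
  A.χ (A.t i) ∘ g ∘ (A.χ i).symm

/-- The (weighted) `C^r` distance between two adapted maps: the supremum over `i`, over
`x ∈ K i` and over `k ≤ r` of the distance between the derivatives of order `k` in charts. -/
def crDist (A : CrGauge E M r) (f g : M → M) : ℝ≥0∞ :=
  ⨆ (i : ℕ) (k : ℕ) (_ : k ≤ r) (x : M) (_ : x ∈ A.K i),
    (A.w i : ℝ≥0∞) * edist (iteratedFDeriv ℝ k (A.local_rep f i) (A.χ i x))
      (iteratedFDeriv ℝ k (A.local_rep g i) (A.χ i x))

end CrGauge

end CrTopology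

section Stability

variable {E : Type*} [NormedAddCommGroup E] [NormedSpace ℝ E]
  {M : Type*} [EMetricSpace M] [ChartedSpace E M] {r : ℕ}

/-- `Λ` is `α`-Hölder stable under `C^r` perturbations: for all `C^r` diffeomorphisms `g` in some
neighbourhood of `f` in the (strong) `C^r` topology there is a homeomorphism `φ` of `Λ` onto its
image in `M` with `φ ∘ f = g ∘ φ` on `Λ` and `d(φ, inclusion) ≤ C d(f, g) ^ α`, with `C`
independent of `g`. The sets `{g | A.Adapted g ∧ A.crDist f g < ε}`, with `A` any gauge to which
`f` is adapted, are a basis of neighbourhoods of `f` for the strong `C^r` topology, which is the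
usual one when `M` is compact. -/
def IsHolderStable (f : M ≃ₘ^r⟮𝓘(ℝ, E), 𝓘(ℝ, E)⟯ M) (Λ : Set M) (α : ℝ) : Prop :=
  ∃ A : CrGauge E M r, A.Adapted f ∧ ∃ ε > (0 : ℝ≥0), ∃ C > (0 : ℝ≥0),
    ∀ g : M ≃ₘ^r⟮𝓘(ℝ, E), 𝓘(ℝ, E)⟯ M, A.Adapted g → A.crDist f g < ε →
      ∃ φ : Λ → M, IsEmbedding φ ∧
        (∀ (x : Λ) (hx : f x ∈ Λ), φ ⟨f x, hx⟩ = g (φ x)) ∧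
        ∀ x : Λ, edist (φ x) (x : M) ≤ C * (A.crDist f g) ^ α

end Stability

end HolderStability

end

/-!
Let `θ` be the coordinate along the centre field `X` in the splitting `ℝ X ⊕ (Es ⊕ Eu)`, so that
`θ (Df v) = a * θ v` over `Λ`. Perturb `f` to `(id + ε W) ∘ f`, where `W` is a vector field
supported in a chart. This changes `f` by `O(ε)` in the `C^r` distance, so Hölder stability
provides a (semi)conjugacy `φ` within `O(ε ^ α)` of the inclusion. Taking the centre coordinate of
the displacement from `x` to `φ x` in a chart gives a function `u` with
`u ∘ f = a * u + ε * θ(W) ∘ f + O((ε + ε ^ α) ^ 2)` on `Λ`, and the error is `o(ε)` because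
`α > 1 / 2`. This twisted cohomological equation is linear, so finitely many choices of `W` add up
to a bounded function with `a * u + c ≤ u ∘ f` on `Λ` for some `c > 0`.

Along a dense orbit such a `u` is either non-negative from some time on, and then the products of
`a` decay exponentially, or always negative, and then they grow exponentially. By density and
continuity the same holds at all points of `Λ`: the centre line is uniformly contracted or
uniformly expanded and can be added to `Es` or to `Eu`.
-/

noncomputable section

namespace HolderStability

section Sequences

variable {a u : ℕ → ℝ} {c K B : ℝ}

theorem prod_mul_le (ha : ∀ i, 0 ≤ a i) (h : ∀ i, a i * u i ≤ u (i + 1)) (k : ℕ) :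
    (∏ i ∈ Finset.range k, a i) * u 0 ≤ u k := by
  induction k with
  | zero => simp
  | succ k ih =>
    rw [Finset.prod_range_succ, mul_right_comm, mul_comm]
    exact (mul_le_mul_of_nonneg_left ih (ha k)).trans (h k)

theorem prod_le_of_supersolution (hc : 0 < c) (ha : ∀ n, 0 ≤ a n) (hu : ∀ n, u n ≤ K)
    (h : ∀ n, a n * u n + c ≤ u (n + 1)) (h0 : c ≤ u 0) (k : ℕ) :
    ∏ i ∈ Finset.range k, a i ≤ K / c * (K / (K + c)) ^ k := by
  have hK : 0 < K := hc.trans_le (h0.trans (hu 0))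
  set q := K / (K + c) with hq
  have hq0 : 0 < q := by positivity
  have hstep (n : ℕ) : a n / q * u n ≤ u (n + 1) := by
    have hcq : (1 - q) * u (n + 1) ≤ c := by
      rw [hq, one_sub_div (by positivity), div_mul_eq_mul_div, div_le_iff₀ (by positivity)]
      nlinarith [hu (n + 1)]
    rw [div_mul_eq_mul_div, div_le_iff₀ hq0]
    linarith [h n]
  have hprod := (prod_mul_le (fun n => div_nonneg (ha n) hq0.le) hstep k).trans (hu k)
  rw [Finset.prod_div_distrib, Finset.prod_const, Finset.card_range, div_mul_eq_mul_div,
    div_le_iff₀ (by positivity)] at hprod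
  rw [div_mul_eq_mul_div, le_div_iff₀ hc]
  exact (mul_le_mul_of_nonneg_left h0 (Finset.prod_nonneg fun i _ => ha i)).trans hprod

theorem one_le_prod_of_supersolution (hc : 0 < c) (ha : ∀ n, 0 ≤ a n) (haB : ∀ n, a n ≤ B)
    (hu : ∀ n, -K ≤ u n) (hneg : ∀ n, u n < 0) (h : ∀ n, a n * u n + c ≤ u (n + 1)) (k : ℕ) :
    1 ≤ K * B / c * (K / (K + c)) ^ k * ∏ i ∈ Finset.range k, a i := by
  have hK : 0 < K := by linarith [hu 0, hneg 0]
  set q := K / (K + c) with hq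
  have hq0 : 0 < q := by positivity
  have hstep (n : ℕ) : q * a n * u n ≤ u (n + 1) := by
    have hcq : -(q * c) ≤ (1 - q) * u (n + 1) := by
      rw [hq, one_sub_div (by positivity), div_mul_eq_mul_div, div_mul_eq_mul_div, ← neg_div]
      gcongr
      nlinarith [hu (n + 1)]
    nlinarith [h n]
  have hprod := prod_mul_le (fun n => mul_nonneg hq0.le (ha n)) hstep k
  rw [Finset.prod_mul_distrib, Finset.prod_const, Finset.card_range] at hprod
  have hB : 0 ≤ B := (ha 0).trans (haB 0)
  have hcB : c ≤ B * -u k := by nlinarith [h k, hneg k, hneg (k + 1), haB k]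
  have hP : 0 ≤ q ^ k * ∏ i ∈ Finset.range k, a i :=
    mul_nonneg (by positivity) (Finset.prod_nonneg fun i _ => ha i)
  rw [div_mul_eq_mul_div, div_mul_eq_mul_div, le_div_iff₀ hc, one_mul]
  calc c ≤ B * -u k := hcB
    _ ≤ B * (q ^ k * (∏ i ∈ Finset.range k, a i) * K) := by
      gcongr
      nlinarith [hu 0]
    _ = K * B * q ^ k * ∏ i ∈ Finset.range k, a i := by ring

theorem prod_decay_or_growth_of_supersolution (hc : 0 < c) (ha : ∀ n, 0 < a n)
    (haB : ∀ n, a n ≤ B) (hu : ∀ n, |u n| ≤ K) (h : ∀ n, a n * u n + c ≤ u (n + 1)) :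
    ∃ C > 0, ∃ μ : ℝ, 0 < μ ∧ μ < 1 ∧
      ((∃ N, ∀ n ≥ N, ∀ k, ∏ i ∈ Finset.range k, a (n + i) ≤ C * μ ^ k) ∨
        ∀ n k, 1 ≤ C * μ ^ k * ∏ i ∈ Finset.range k, a (n + i)) := by
  have hK : 0 < K := by
    refine lt_of_le_of_ne ((abs_nonneg _).trans (hu 0)) fun hK => ?_
    have hu0 (n : ℕ) : u n = 0 := abs_nonpos_iff.1 (hK ▸ hu n)
    have := h 0
    simp only [hu0, mul_zero, zero_add] at this
    exact hc.not_ge this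
  have hB : 0 < B := (ha 0).trans_le (haB 0)
  have hq : 0 < K / (K + c) := by positivity
  have hq1 : K / (K + c) < 1 := (div_lt_one (by positivity)).2 (by linarith)
  by_cases hN : ∃ N, 0 ≤ u N
  · obtain ⟨N, hN⟩ := hN
    have hpos : ∀ n ≥ N + 1, c ≤ u n := fun n hn => by
      induction n, hn using Nat.le_induction with
      | base => nlinarith [h N, mul_nonneg (ha N).le hN]
      | succ n _ ih => nlinarith [h n, ha n]
    exact ⟨K / c, by positivity, _, hq, hq1, .inl ⟨N + 1, fun n hn k =>
      prod_le_of_supersolution (u := fun i => u (n + i)) hc (fun i => (ha _).le)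
        (fun i => (abs_le.1 (hu _)).2) (fun i => h _) (hpos n hn) k⟩⟩
  · push Not at hN
    exact ⟨K * B / c, by positivity, _, hq, hq1, .inr fun n k =>
      one_le_prod_of_supersolution (u := fun i => u (n + i)) hc (fun i => (ha _).le)
        (fun i => haB _) (fun i => (abs_le.1 (hu _)).1) (fun i => hN _) (fun i => h _) k⟩

end Sequences

section UniformConstants

variable {X : Type*} [TopologicalSpace X]

theorem eventually_atTop_forall_of_isCompact {s : Set X} (hs : IsCompact s) {P : ℝ → X → Prop}
    (h : ∀ p ∈ s, ∃ U ∈ 𝓝[s] p, ∀ᶠ K in atTop, ∀ x ∈ U, P K x) :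
    ∀ᶠ K in atTop, ∀ x ∈ s, P K x :=
  hs.induction_on (p := fun t => ∀ᶠ K in atTop, ∀ x ∈ t, P K x) (by simp)
    (fun _ _ hst ht => ht.mono fun _ hK x hx => hK x (hst hx))
    (fun _ _ hs ht => (hs.and ht).mono fun _ hK x hx => hx.elim (hK.1 x) (hK.2 x)) h

theorem isBigO_prod_principal_of_isCompact {α F G : Type*} [Norm F] [SeminormedAddCommGroup G]
    {l : Filter α} {f : α × X → F} {g : α × X → G} {s : Set X} (hs : IsCompact s)
    (h : ∀ p ∈ s, f =O[l ×ˢ 𝓝[s] p] g) : f =O[l ×ˢ 𝓟 s] g := by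
  refine hs.induction_on (p := fun t => f =O[l ×ˢ 𝓟 t] g) (by simp)
    (fun _ _ hst ht => ht.mono (prod_mono le_rfl (principal_mono.2 hst)))
    (fun t t' ht ht' => by simpa only [← sup_principal, prod_sup] using ht.sup ht') ?_
  intro p hp
  obtain ⟨C, hC⟩ := (h p hp).bound
  obtain ⟨V, hV, U, hU, hVU⟩ := mem_prod_iff.1 hC
  exact ⟨U, hU, .of_bound C (mem_prod_iff.2 ⟨V, hV, U, mem_principal_self U, hVU⟩)⟩

end UniformConstants

section Calculus

variable {E F G : Type*} [NormedAddCommGroup E] [NormedSpace ℝ E]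
  [NormedAddCommGroup F] [NormedSpace ℝ F] [NormedAddCommGroup G] [NormedSpace ℝ G]

theorem norm_image_sub_le_of_lipschitzOnWith_fderiv {f : F → G} {s : Set F} {L : ℝ≥0}
    (hs : Convex ℝ s) (hf : ∀ x ∈ s, DifferentiableAt ℝ f x)
    (hL : LipschitzOnWith L (fderiv ℝ f) s) {x y : F} (hx : x ∈ s) (hy : y ∈ s) :
    ‖f y - f x - fderiv ℝ f x (y - x)‖ ≤ L * ‖y - x‖ ^ 2 := by
  have hseg : segment ℝ x y ⊆ s := hs.segment_subset hx hy
  rw [sq, ← mul_assoc]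
  refine (convex_segment x y).norm_image_sub_le_of_norm_hasFDerivWithin_le'
    (fun z hz => (hf z (hseg hz)).hasFDerivAt.hasFDerivWithinAt) (fun z hz => ?_)
    (left_mem_segment ℝ x y) (right_mem_segment ℝ x y)
  calc ‖fderiv ℝ f z - fderiv ℝ f x‖ ≤ L * ‖z - x‖ := by
        simpa only [dist_eq_norm] using hL.dist_le_mul z (hseg hz) x hx
    _ ≤ L * ‖y - x‖ := by
        gcongr
        simpa only [norm_sub_rev] using norm_sub_le_of_mem_segment hz

theorem exists_eventually_taylor_of_contDiffAt {f : F → G} {q₀ : F} (hf : ContDiffAt ℝ 2 f q₀) :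
    ∃ U ∈ 𝓝 q₀, ∀ᶠ K : ℝ in atTop, ∀ q ∈ U, ∀ q', ‖q' - q‖ < K⁻¹ →
      ‖f q' - f q - fderiv ℝ f q (q' - q)‖ ≤ K * ‖q' - q‖ ^ 2 := by
  obtain ⟨L, t, ht, hL⟩ :=
    (hf.fderiv_right (m := 1) one_add_one_eq_two.le).exists_lipschitzOnWith
  have hd : ∀ᶠ q in 𝓝 q₀, DifferentiableAt ℝ f q :=
    (hf.eventually (by simp)).mono fun q hq => hq.differentiableAt (by simp)
  obtain ⟨δ, hδ, hball⟩ := Metric.mem_nhds_iff.1 (inter_mem ht hd)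
  refine ⟨Metric.ball q₀ (δ / 2), Metric.ball_mem_nhds _ (half_pos hδ), ?_⟩
  filter_upwards [tendsto_inv_atTop_zero.eventually (ge_mem_nhds (half_pos hδ)),
    eventually_ge_atTop (L : ℝ)] with K hK hLK q hq q' hq'
  have hq'δ : q' ∈ Metric.ball q₀ δ :=
    calc dist q' q₀ ≤ dist q' q + dist q q₀ := dist_triangle _ _ _
      _ < δ / 2 + δ / 2 := add_lt_add (dist_eq_norm q' q ▸ hq'.trans_le hK) hq
      _ = δ := add_halves δ
  exact (norm_image_sub_le_of_lipschitzOnWith_fderiv (convex_ball _ _)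
    (fun x hx => (hball hx).2) (hL.mono fun x hx => (hball hx).1)
    (Metric.ball_subset_ball (half_le_self hδ.le) hq) hq'δ).trans (by gcongr)

theorem contDiffAt_iteratedFDeriv_param {f : ℝ → E → G} {p : ℝ × E} {k m : ℕ}
    (hf : ContDiffAt ℝ ((m + k : ℕ) : ℕ∞ω) (Function.uncurry f) p) :
    ContDiffAt ℝ m (fun q : ℝ × E => iteratedFDeriv ℝ k (f q.1) q.2) p := by
  induction k generalizing m with
  | zero =>
    exact (show ContDiffAt ℝ m _ p from hf).continuousLinearMap_comp
      ((continuousMultilinearCurryFin0 ℝ E G).symm : _ →L[ℝ] E [×0]→L[ℝ] G)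
  | succ k ih =>
    have hk := ih (m := m + 1) (by convert hf using 2; ring)
    have hfderiv : ContDiffAt ℝ m
        (fun q : ℝ × E => fderiv ℝ (fun w : E => iteratedFDeriv ℝ k (f q.1) w) q.2) p := by
      refine ContDiffAt.fderiv (n := ((m + 1 : ℕ) : ℕ∞ω))
        (f := fun (q : ℝ × E) w => iteratedFDeriv ℝ k (f q.1) w) ?_ contDiffAt_snd (by simp)
      exact hk.comp (p, p.2) (f := fun q : (ℝ × E) × E => (q.1.1, q.2)) (by fun_prop)
    exact hfderiv.continuousLinearMap_comp
      ((continuousMultilinearCurryLeftEquiv ℝ (fun _ : Fin (k + 1) => E) G).symm :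
        _ →L[ℝ] E [×(k + 1)]→L[ℝ] G)

theorem isBigO_iteratedFDeriv_fst {f : ℝ → E → G} {w₀ : E} {k r : ℕ} (hk : k ≤ r)
    (hf : ContDiffAt ℝ ((r + 1 : ℕ) : ℕ∞ω) (Function.uncurry f) (0, w₀))
    (hf0 : f 0 =ᶠ[𝓝 w₀] 0) :
    (fun q : ℝ × E => iteratedFDeriv ℝ k (f q.1) q.2) =O[𝓝 (0, w₀)] Prod.fst := by
  have hfk : ContDiffAt ℝ 1 (fun q : ℝ × E => iteratedFDeriv ℝ k (f q.1) q.2) (0, w₀) := by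
    exact_mod_cast contDiffAt_iteratedFDeriv_param (m := 1)
      (hf.of_le (by exact_mod_cast (by lia : 1 + k ≤ r + 1)))
  obtain ⟨L, t, ht, hL⟩ := hfk.exists_lipschitzOnWith
  have hbase : Tendsto (fun q : ℝ × E => ((0 : ℝ), q.2)) (𝓝 (0, w₀)) (𝓝 (0, w₀)) :=
    (by fun_prop : Continuous fun q : ℝ × E => ((0 : ℝ), q.2)).tendsto (0, w₀)
  refine .of_bound L ?_
  filter_upwards [ht, hbase.eventually ht,
    continuousAt_snd.eventually (hf0.iteratedFDeriv ℝ k)] with q hq hq' h0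
  have hlip := hL.dist_le_mul q hq (0, q.2) hq'
  rwa [h0, show iteratedFDeriv ℝ k (0 : E → G) q.2 = 0 from congrFun iteratedFDeriv_fun_zero _,
    dist_zero_right, Prod.dist_eq, dist_self, dist_zero_right,
    max_eq_left (norm_nonneg _)] at hlip

theorem norm_iteratedFDeriv_comp_le_of_contDiffAt {g : F → G} {h : E → F} {y : E} {n : ℕ}
    {C D : ℝ} (hg : ContDiffAt ℝ n g (h y)) (hh : ContDiffAt ℝ n h y)
    (hC : ∀ i ≤ n, ‖iteratedFDeriv ℝ i g (h y)‖ ≤ C)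
    (hD : ∀ i, 1 ≤ i → i ≤ n → ‖iteratedFDeriv ℝ i h y‖ ≤ D ^ i) :
    ‖iteratedFDeriv ℝ n (g ∘ h) y‖ ≤ n.factorial * C * D ^ n := by
  obtain ⟨t, ht, hto, hyt⟩ := mem_nhds_iff.1 (hg.eventually (by simp))
  obtain ⟨s, hs, hso, hys⟩ := mem_nhds_iff.1 (inter_mem (hh.eventually (by simp))
    (hh.continuousAt.preimage_mem_nhds (hto.mem_nhds hyt)))
  have hgt : ContDiffOn ℝ n g t :=
    fun w hw => (show ContDiffAt ℝ n g w from ht hw).contDiffWithinAt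
  have hhs : ContDiffOn ℝ n h s :=
    fun w hw => (show ContDiffAt ℝ n h w from (hs hw).1).contDiffWithinAt
  rw [← iteratedFDerivWithin_of_isOpen n hso hys]
  refine norm_iteratedFDerivWithin_comp_le hgt hhs le_rfl hto.uniqueDiffOn
    hso.uniqueDiffOn (fun w hw => (hs hw).2) hys (fun i hi => ?_) fun i hi hin => ?_
  · rw [iteratedFDerivWithin_of_isOpen i hto hyt]
    exact hC i hi
  · rw [iteratedFDerivWithin_of_isOpen i hso hys]
    exact hD i hi hin

theorem isBigO_iteratedFDeriv_comp_fst {f : ℝ → F → G} {h : E → F} {y₀ : E} {k r : ℕ}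
    (hk : k ≤ r) (hf : ContDiffAt ℝ ((r + 1 : ℕ) : ℕ∞ω) (Function.uncurry f) (0, h y₀))
    (hf0 : f 0 =ᶠ[𝓝 (h y₀)] 0) (hh : ContDiffAt ℝ r h y₀) :
    (fun q : ℝ × E => iteratedFDeriv ℝ k (f q.1 ∘ h) q.2) =O[𝓝 (0, y₀)] Prod.fst := by
  have hcont : ContinuousAt (fun q : ℝ × E => (q.1, h q.2)) (0, y₀) :=
    continuousAt_fst.prodMk (hh.continuousAt.comp continuousAt_snd)
  have hbound : ∀ i ∈ Iic k, ∀ᶠ D in atTop, ∀ᶠ q in 𝓝 ((0 : ℝ), y₀),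
      ‖iteratedFDeriv ℝ i (f q.1) (h q.2)‖ ≤ D * ‖q.1‖ ∧ ‖iteratedFDeriv ℝ i h q.2‖ ≤ D := by
    intro i hi
    have hsmall := Asymptotics.isBigO_iff_eventually.1
      ((isBigO_iteratedFDeriv_fst (le_trans hi hk) hf hf0).comp_tendsto hcont)
    filter_upwards [hsmall, eventually_gt_atTop ‖iteratedFDeriv ℝ i h y₀‖] with D hD hDi
    have hnear := (hh.continuousAt_iteratedFDeriv
      (by exact_mod_cast le_trans hi hk)).norm.eventually (gt_mem_nhds hDi)
    filter_upwards [hD, continuousAt_snd.eventually hnear] with q hq hq'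
    exact ⟨hq, hq'.le⟩
  obtain ⟨D, hD, hD1⟩ :=
    (((eventually_all_finite (finite_Iic k)).2 hbound).and (eventually_ge_atTop 1)).exists
  have hkr : (k : ℕ∞ω) ≤ r := by exact_mod_cast hk
  refine .of_bound (k.factorial * D * D ^ k) ?_
  filter_upwards [(eventually_all_finite (finite_Iic k)).2 hD,
    hcont.eventually (hf.eventually (by simp)),
    continuousAt_snd.eventually (hh.eventually (by simp))] with q hq hfq hhq
  have hfq' : ContDiffAt ℝ k (f q.1) (h q.2) :=
    (hfq.of_le (by exact_mod_cast hk.trans r.le_succ)).comp (h q.2)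
      (f := fun w => (q.1, w)) (by fun_prop)
  calc ‖iteratedFDeriv ℝ k (f q.1 ∘ h) q.2‖ ≤ k.factorial * (D * ‖q.1‖) * D ^ k :=
        norm_iteratedFDeriv_comp_le_of_contDiffAt hfq' (hhq.of_le hkr) (fun i hi => (hq i hi).1)
          fun i hi hik => (hq i hik).2.trans (le_self_pow₀ hD1 (by lia))
    _ = k.factorial * D * D ^ k * ‖q.1‖ := by ring

end Calculus

section PerturbationOfIdentity

variable {E : Type*} [NormedAddCommGroup E] [NormedSpace ℝ E] [CompleteSpace E]

theorem isInvertible_id_add {A : E →L[ℝ] E} (hA : ‖A‖ < 1) :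
    (ContinuousLinearMap.id ℝ E + A).IsInvertible := by
  have hA' : ‖-A‖ < 1 := by rwa [norm_neg]
  refine ⟨ContinuousLinearEquiv.ofUnit (Units.oneSub (-A) hA'), ?_⟩
  ext v
  simp [ContinuousLinearEquiv.ofUnit]

theorem exists_diffeomorph_id_add {g : E → E} {n : ℕ∞ω} {c : ℝ≥0} (hn : n ≠ 0)
    (hg : ContDiff ℝ n g) (hc : LipschitzWith c g) (hc1 : c < 1) :
    ∃ Φ : E ≃ₘ^n⟮𝓘(ℝ, E), 𝓘(ℝ, E)⟯ E, ∀ x, Φ x = x + g x := by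
  have happ : ApproximatesLinearOn (fun x => x + g x)
      (ContinuousLinearEquiv.refl ℝ E : E →L[ℝ] E) univ c := by
    intro x _ y _
    simpa [add_sub_add_comm, dist_eq_norm] using hc.dist_le_mul x y
  have hN : Subsingleton E ∨ c < ‖((ContinuousLinearEquiv.refl ℝ E).symm : E →L[ℝ] E)‖₊⁻¹ := by
    refine (subsingleton_or_nontrivial E).imp_right fun (_ : Nontrivial E) => ?_
    rwa [ContinuousLinearEquiv.refl_symm, ContinuousLinearEquiv.coe_refl,
      ContinuousLinearMap.nnnorm_id, inv_one]
  set h := happ.toHomeomorph _ hN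
  have hsmooth : ContDiff ℝ n h := contDiff_id.add hg
  have hsymm : ContDiff ℝ n h.symm := by
    have hderiv (x : E) : (ContinuousLinearMap.id ℝ E + fderiv ℝ g x).IsInvertible :=
      isInvertible_id_add ((norm_fderiv_le_of_lipschitz ℝ hc).trans_lt hc1)
    choose e he using hderiv
    refine h.contDiff_symm (f₀' := e) (fun x => ?_) hsmooth
    rw [he]
    exact (hasFDerivAt_id x).add (hg.differentiable hn x).hasFDerivAt
  exact ⟨⟨h.toEquiv, contMDiff_iff_contDiff.2 hsmooth, contMDiff_iff_contDiff.2 hsymm⟩,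
    fun _ => rfl⟩

end PerturbationOfIdentity

section Frames

variable {X E F G : Type*} [TopologicalSpace X] [NormedAddCommGroup E] [NormedSpace ℝ E]
  [NormedAddCommGroup F] [NormedSpace ℝ F] [NormedAddCommGroup G] [NormedSpace ℝ G]
  {s : Set X} {p : X}

theorem continuousWithinAt_of_comp_eq_const [CompleteSpace F] (hp : p ∈ s) {A : X → F →L[ℝ] E}
    (hA : ContinuousWithinAt A s p) (hAp : (A p).IsInvertible) {l : X → E →L[ℝ] G}
    {L : F →L[ℝ] G} (hl : ∀ᶠ q in 𝓝[s] p, l q ∘L A q = L) : ContinuousWithinAt l s p := by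
  obtain ⟨e, he⟩ := hAp
  have hinv : ContinuousWithinAt (fun q => (A q).inverse) s p :=
    (he ▸ (contDiffAt_map_inverse (𝕜 := ℝ) (n := 0) e).continuousAt).comp_continuousWithinAt hA
  have hev : ∀ᶠ q in 𝓝[s] p, l q = L ∘L (A q).inverse := by
    filter_upwards [hl, hA.eventually (he ▸ e.nhds)] with q hq ⟨e', he'⟩
    rw [← hq, ← he', ContinuousLinearMap.inverse_equiv, ContinuousLinearMap.comp_assoc,
      ContinuousLinearEquiv.coe_comp_coe_symm, ContinuousLinearMap.comp_id]
  exact (continuousWithinAt_const.clm_comp hinv).congr_of_eventuallyEq hev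
    (hev.self_of_nhdsWithin hp)

theorem continuousWithinAt_of_apply_frame {ι : Type*} [Finite ι]
    (hp : p ∈ s) {b : ι → X → E} (hb : ∀ i, ContinuousWithinAt (b i) s p)
    (hli : LinearIndependent ℝ fun i => b i p)
    (hsp : ⊤ ≤ Submodule.span ℝ (range fun i => b i p)) {l : X → E →L[ℝ] G} {c : ι → G}
    (hl : ∀ᶠ q in 𝓝[s] p, ∀ i, l q (b i q) = c i) : ContinuousWithinAt l s p := by
  have := Fintype.ofFinite ι
  let A (q : X) : (ι → ℝ) →L[ℝ] E := ∑ i, (ContinuousLinearMap.proj i).smulRight (b i q)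
  refine continuousWithinAt_of_comp_eq_const (A := A)
    (L := ∑ i, (ContinuousLinearMap.proj i).smulRight (c i)) hp ?_
    ⟨(Module.Basis.mk hli hsp).equivFun.symm.toContinuousLinearEquiv, ?_⟩ ?_
  · refine tendsto_finsetSum _ fun i _ => ?_
    exact ((ContinuousLinearMap.smulRightL ℝ (ι → ℝ) E
      (ContinuousLinearMap.proj i)).continuous.tendsto _).comp (hb i)
  · ext v
    simp [A, Module.Basis.equivFun_symm_apply]
  · filter_upwards [hl] with q hq
    ext v
    simp [A, map_sum, hq]

end Frames

section ChartDerivative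

variable {E : Type*} [NormedAddCommGroup E] [NormedSpace ℝ E]
  {M : Type*} [TopologicalSpace M] [ChartedSpace E M]
  {E' : Type*} [NormedAddCommGroup E'] [NormedSpace ℝ E']
  {M' : Type*} [TopologicalSpace M'] [ChartedSpace E' M']

/-- The derivative of a chart, with values in the model space. -/
def chartDeriv (χ : OpenPartialHomeomorph M E) (x : M) : TangentSpace 𝓘(ℝ, E) x →L[ℝ] E :=
  mfderiv 𝓘(ℝ, E) 𝓘(ℝ, E) χ x

/-- The linear forms `θ` on the tangent spaces, read in the chart `χ`. -/
def chartForm (χ : OpenPartialHomeomorph M E) (θ : ∀ x : M, TangentSpace 𝓘(ℝ, E) x →L[ℝ] ℝ)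
    (x : M) : E →L[ℝ] ℝ :=
  (θ x).comp (chartDeriv χ x).inverse

variable {χ : OpenPartialHomeomorph M E} {χ' : OpenPartialHomeomorph M' E'} {x p : M}

theorem isInvertible_chartDeriv (hχ : χ ∈ IsManifold.maximalAtlas 𝓘(ℝ, E) 1 M)
    (hx : x ∈ χ.source) : (chartDeriv χ x).IsInvertible :=
  have h : χ.MDifferentiable 𝓘(ℝ, E) 𝓘(ℝ, E) :=
    ⟨fun _ hy => (mdifferentiableAt_of_mem_maximalAtlas hχ hy).mdifferentiableWithinAt,
      fun _ hy => (mdifferentiableAt_symm_of_mem_maximalAtlas hχ hy).mdifferentiableWithinAt⟩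
  ⟨h.mfderiv hx, rfl⟩

theorem chartForm_chartDeriv (hχ : χ ∈ IsManifold.maximalAtlas 𝓘(ℝ, E) 1 M) (hx : x ∈ χ.source)
    (θ : ∀ x : M, TangentSpace 𝓘(ℝ, E) x →L[ℝ] ℝ) (u : TangentSpace 𝓘(ℝ, E) x) :
    chartForm χ θ x (chartDeriv χ x u) = θ x u :=
  congrArg (θ x) ((isInvertible_chartDeriv hχ hx).inverse_apply_self u)

theorem fderiv_comp_chartDeriv (hχ : χ ∈ IsManifold.maximalAtlas 𝓘(ℝ, E) 1 M)
    (hχ' : χ' ∈ IsManifold.maximalAtlas 𝓘(ℝ, E') 1 M') {h : M → M'}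
    (hh : MDifferentiableAt 𝓘(ℝ, E) 𝓘(ℝ, E') h x) (hx : x ∈ χ.source) (hhx : h x ∈ χ'.source)
    (u : TangentSpace 𝓘(ℝ, E) x) :
    fderiv ℝ (χ' ∘ h ∘ χ.symm) (χ x) (chartDeriv χ x u) =
      chartDeriv χ' (h x) (mfderiv 𝓘(ℝ, E) 𝓘(ℝ, E') h x u) := by
  have hdχ : MDifferentiableAt 𝓘(ℝ, E) 𝓘(ℝ, E) χ x := mdifferentiableAt_of_mem_maximalAtlas hχ hx
  have hdχ' : MDifferentiableAt 𝓘(ℝ, E') 𝓘(ℝ, E') χ' (h x) :=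
    mdifferentiableAt_of_mem_maximalAtlas hχ' hhx
  have hdsymm : MDifferentiableAt 𝓘(ℝ, E) 𝓘(ℝ, E) χ.symm (χ x) :=
    mdifferentiableAt_symm_of_mem_maximalAtlas hχ (χ.map_source hx)
  have hrep : MDifferentiableAt 𝓘(ℝ, E) 𝓘(ℝ, E') (χ' ∘ h ∘ χ.symm) (χ x) := by
    refine MDifferentiableAt.comp (I' := 𝓘(ℝ, E)) (f := χ.symm) (g := χ' ∘ h) (χ x) ?_ hdsymm
    rw [χ.left_inv hx]
    exact hdχ'.comp x hh
  have hcongr : (χ' ∘ h ∘ χ.symm) ∘ χ =ᶠ[𝓝 x] χ' ∘ h := by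
    filter_upwards [χ.open_source.mem_nhds hx] with y hy
    simp only [Function.comp_apply, χ.left_inv hy]
  have hleft : mfderiv 𝓘(ℝ, E) 𝓘(ℝ, E') ((χ' ∘ h ∘ χ.symm) ∘ χ) x u =
      fderiv ℝ (χ' ∘ h ∘ χ.symm) (χ x) (chartDeriv χ x u) := by
    rw [mfderiv_comp_apply x (I'' := 𝓘(ℝ, E')) hrep hdχ u, mfderiv_eq_fderiv]
    rfl
  have hright : mfderiv 𝓘(ℝ, E) 𝓘(ℝ, E') (χ' ∘ h) x u =
      chartDeriv χ' (h x) (mfderiv 𝓘(ℝ, E) 𝓘(ℝ, E') h x u) :=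
    mfderiv_comp_apply x (I'' := 𝓘(ℝ, E')) hdχ' hh u
  exact hleft.symm.trans ((congrArg (fun L => L u)
    (hcongr.mfderiv_eq (I := 𝓘(ℝ, E)) (I' := 𝓘(ℝ, E')))).trans hright)

theorem fderiv_transition_chartDeriv {χ' : OpenPartialHomeomorph M E}
    (hχ : χ ∈ IsManifold.maximalAtlas 𝓘(ℝ, E) 1 M)
    (hχ' : χ' ∈ IsManifold.maximalAtlas 𝓘(ℝ, E) 1 M) (hx : x ∈ χ.source) (hx' : x ∈ χ'.source)
    (u : TangentSpace 𝓘(ℝ, E) x) :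
    fderiv ℝ (χ' ∘ χ.symm) (χ x) (chartDeriv χ x u) = chartDeriv χ' x u := by
  simpa only [mfderiv_id, Function.id_comp, id_eq, ContinuousLinearMap.coe_id'] using
    fderiv_comp_chartDeriv hχ hχ' (h := id) mdifferentiableAt_id hx hx' u

theorem contDiffAt_chart_comp {n : ℕ∞ω} (hχ : χ ∈ IsManifold.maximalAtlas 𝓘(ℝ, E) n M)
    (hχ' : χ' ∈ IsManifold.maximalAtlas 𝓘(ℝ, E') n M') {h : M → M'}
    (hh : ContMDiffAt 𝓘(ℝ, E) 𝓘(ℝ, E') n h x) (hx : x ∈ χ.source) (hhx : h x ∈ χ'.source) :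
    ContDiffAt ℝ n (χ' ∘ h ∘ χ.symm) (χ x) := by
  rw [← contMDiffAt_iff_contDiffAt]
  refine ContMDiffAt.comp (I' := 𝓘(ℝ, E)) (f := χ.symm) (g := χ' ∘ h) (χ x) ?_
    (contMDiffAt_symm_of_mem_maximalAtlas hχ (χ.map_source hx))
  rw [χ.left_inv hx]
  exact (contMDiffAt_of_mem_maximalAtlas hχ' hhx).comp x hh

variable [IsManifold 𝓘(ℝ, E) 1 M]

theorem ContinuousField.chartDeriv (hχ : χ ∈ IsManifold.maximalAtlas 𝓘(ℝ, E) 1 M)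
    {S : Set M} {Y : ∀ x : M, TangentSpace 𝓘(ℝ, E) x} (hY : ContinuousField S Y) (hp : p ∈ S)
    (hpχ : p ∈ χ.source) : ContinuousWithinAt (fun q => chartDeriv χ q (Y q)) S p := by
  have htangent : ContinuousAt (tangentMapWithin 𝓘(ℝ, E) 𝓘(ℝ, E) χ χ.source)
      (⟨p, Y p⟩ : TangentBundle 𝓘(ℝ, E) M) :=
    ((contMDiffOn_of_mem_maximalAtlas hχ).continuousOn_tangentMapWithin le_rfl
      χ.open_source.uniqueMDiffOn).continuousAt
      ((χ.open_source.preimage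
        (FiberBundle.continuous_proj E (TangentSpace 𝓘(ℝ, E)))).mem_nhds hpχ)
  have hsnd := (continuous_snd (X := E) (Y := E)).continuousAt.comp_continuousWithinAt
    (((tangentBundleModelSpaceHomeomorph 𝓘(ℝ, E)).continuous.continuousAt.comp
      htangent).comp_continuousWithinAt
        (f := fun x => (⟨x, Y x⟩ : TangentBundle 𝓘(ℝ, E) M)) (hY p hp))
  have heq : ∀ q ∈ χ.source, HolderStability.chartDeriv χ q (Y q) =
      (tangentMapWithin 𝓘(ℝ, E) 𝓘(ℝ, E) χ χ.source ⟨q, Y q⟩).2 := fun q hq => by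
    simp only [tangentMapWithin, mfderivWithin_of_isOpen χ.open_source hq]
    rfl
  exact hsnd.congr_of_eventuallyEq
    (mem_nhdsWithin_of_mem_nhds (mem_of_superset (χ.open_source.mem_nhds hpχ) heq)) (heq p hpχ)

end ChartDerivative

section ChartLipschitz

variable {E : Type*} [NormedAddCommGroup E] [NormedSpace ℝ E]

section Riemannian

variable {M : Type*} [TopologicalSpace M] [ChartedSpace E M]
  [RiemannianBundle (fun x : M => TangentSpace 𝓘(ℝ, E) x)] {χ : OpenPartialHomeomorph M E}

theorem edist_chart_le_mul_pathELength (hχ : χ ∈ IsManifold.maximalAtlas 𝓘(ℝ, E) 1 M)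
    {γ : ℝ → M} {C : ℝ≥0} (hγ : ContMDiff 𝓘(ℝ, ℝ) 𝓘(ℝ, E) 1 γ)
    (hγχ : ∀ t ∈ Icc (0 : ℝ) 1, γ t ∈ χ.source)
    (hC : ∀ t ∈ Icc (0 : ℝ) 1, ∀ u, ‖chartDeriv χ (γ t) u‖ₑ ≤ C * ‖u‖ₑ) :
    edist (χ (γ 0)) (χ (γ 1)) ≤ C * Manifold.pathELength 𝓘(ℝ, E) γ 0 1 := by
  have hderiv : ∀ t ∈ Icc (0 : ℝ) 1, derivWithin (χ ∘ γ) (Icc 0 1) t =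
      chartDeriv χ (γ t) (mfderivWithin 𝓘(ℝ, ℝ) 𝓘(ℝ, E) γ (Icc 0 1) t 1) := by
    intro t ht
    rw [← fderivWithin_derivWithin, ← mfderivWithin_eq_fderivWithin]
    refine congrArg (fun L => L 1) (mfderiv_comp_mfderivWithin t
      (mdifferentiableAt_of_mem_maximalAtlas hχ (hγχ t ht))
      ((hγ.mdifferentiable one_ne_zero).mdifferentiableOn _ ht) ?_)
    exact (uniqueDiffOn_Icc zero_lt_one _ ht).uniqueMDiffWithinAt
  rw [edist_comm, edist_eq_enorm_sub, Manifold.pathELength_eq_lintegral_mfderivWithin_Icc,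
    ← MeasureTheory.lintegral_const_mul' _ _ ENNReal.coe_ne_top]
  calc ‖χ (γ 1) - χ (γ 0)‖ₑ ≤ ∫⁻ t in Icc 0 1, ‖derivWithin (χ ∘ γ) (Icc 0 1) t‖ₑ := by
        refine enorm_sub_le_lintegral_derivWithin_Icc_of_contDiffOn_Icc (f := χ ∘ γ) ?_ zero_le_one
        exact contMDiffOn_iff_contDiffOn.1
          ((contMDiffOn_of_mem_maximalAtlas hχ).comp hγ.contMDiffOn hγχ)
    _ ≤ ∫⁻ t in Icc 0 1, C * ‖mfderivWithin 𝓘(ℝ, ℝ) 𝓘(ℝ, E) γ (Icc 0 1) t 1‖ₑ :=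
        MeasureTheory.setLIntegral_mono' measurableSet_Icc fun t ht => by
          rw [hderiv t ht]
          exact hC t ht _

theorem exists_eventually_enorm_chartDeriv_le [IsManifold 𝓘(ℝ, E) 1 M]
    [IsContinuousRiemannianBundle E (fun x : M => TangentSpace 𝓘(ℝ, E) x)] {p : M}
    (hχ : χ ∈ IsManifold.maximalAtlas 𝓘(ℝ, E) 1 M) (hp : p ∈ χ.source) :
    ∃ C : ℝ≥0, ∀ᶠ q in 𝓝 p, ∀ u : TangentSpace 𝓘(ℝ, E) q, ‖chartDeriv χ q u‖ₑ ≤ C * ‖u‖ₑ := by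
  obtain ⟨B, -, hB⟩ := eventually_norm_trivializationAt_lt E
    (fun x : M => TangentSpace 𝓘(ℝ, E) x) p
  have hc : chartAt E p ∈ IsManifold.maximalAtlas 𝓘(ℝ, E) 1 M :=
    IsManifold.chart_mem_maximalAtlas p
  set T := fderiv ℝ (χ ∘ (chartAt E p).symm)
  have hT : ContinuousAt (fun q => T (chartAt E p q)) p :=
    ((contDiffAt_chart_comp hc hχ contMDiffAt_id (mem_chart_source E p) hp).continuousAt_fderiv
      one_ne_zero).comp ((chartAt E p).continuousAt (mem_chart_source E p))
  refine ⟨(‖T (chartAt E p p)‖₊ + 1) * B.toNNReal, ?_⟩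
  filter_upwards [hT.nnnorm.eventually (gt_mem_nhds (lt_add_one _)), hB,
    χ.open_source.mem_nhds hp, chart_source_mem_nhds E p] with q hq hqB hqχ hqc u
  have hcu : ‖chartDeriv (chartAt E p) q u‖ₑ ≤ B.toNNReal * ‖u‖ₑ := by
    have hle := ContinuousLinearMap.le_of_opNorm_le _ (hqB.le.trans (Real.le_coe_toNNReal B)) u
    rw [TangentBundle.continuousLinearMapAt_trivializationAt (I := 𝓘(ℝ, E)) hqc] at hle
    have hnorm : ‖chartDeriv (chartAt E p) q u‖₊ ≤ B.toNNReal * ‖u‖₊ := hle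
    rw [enorm_eq_nnnorm, enorm_eq_nnnorm, ← ENNReal.coe_mul]
    exact ENNReal.coe_le_coe.2 hnorm
  rw [← fderiv_transition_chartDeriv hc hχ hqc hqχ u, ENNReal.coe_mul, mul_assoc]
  exact (T (chartAt E p q)).le_opENorm _ |>.trans (mul_le_mul' (by exact_mod_cast hq.le) hcu)

end Riemannian

variable {M : Type*} [EMetricSpace M] [ChartedSpace E M]
  [RiemannianBundle (fun x : M => TangentSpace 𝓘(ℝ, E) x)]
  {χ : OpenPartialHomeomorph M E} {p : M}

theorem edist_chart_le_mul_edist [IsRiemannianManifold 𝓘(ℝ, E) M]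
    (hχ : χ ∈ IsManifold.maximalAtlas 𝓘(ℝ, E) 1 M) {x y : M} {C : ℝ≥0} {R : ℝ≥0∞}
    (hR : Metric.eball x R ⊆ χ.source)
    (hC : ∀ z ∈ Metric.eball x R, ∀ u, ‖chartDeriv χ z u‖ₑ ≤ C * ‖u‖ₑ) (hxy : edist x y < R) :
    edist (χ x) (χ y) ≤ C * edist x y := by
  have hpath : ∀ b ∈ Ioo (edist x y) R, edist (χ x) (χ y) ≤ C * b := by
    rintro b ⟨hb, hbR⟩
    rw [IsRiemannianManifold.out (I := 𝓘(ℝ, E)) x y] at hb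
    obtain ⟨γ, hγx, hγy, hγ, hlen, -⟩ :=
      exists_lt_locally_constant_of_riemannianEDist_lt hb zero_lt_one
    have hmem : ∀ t ∈ Icc (0 : ℝ) 1, γ t ∈ Metric.eball x R := by
      intro t ht
      rw [Metric.mem_eball, edist_comm, IsRiemannianManifold.out (I := 𝓘(ℝ, E)) x (γ t)]
      calc Manifold.riemannianEDist 𝓘(ℝ, E) x (γ t)
          ≤ Manifold.pathELength 𝓘(ℝ, E) γ 0 t :=
            Manifold.riemannianEDist_le_pathELength hγ.contMDiffOn hγx rfl ht.1
        _ ≤ Manifold.pathELength 𝓘(ℝ, E) γ 0 1 := Manifold.pathELength_mono le_rfl ht.2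
        _ < R := hlen.trans hbR
    rw [← hγx, ← hγy]
    exact (edist_chart_le_mul_pathELength hχ hγ (fun t ht => hR (hmem t ht))
      fun t ht => hC _ (hmem t ht)).trans (by gcongr)
  have : (𝓝[>] edist x y).NeBot := nhdsGT_neBot_of_exists_gt ⟨R, hxy⟩
  exact ge_of_tendsto (((ENNReal.continuous_const_mul ENNReal.coe_ne_top).tendsto _).mono_left
    nhdsWithin_le_nhds) (mem_of_superset (Ioo_mem_nhdsGT hxy) hpath)

variable [IsManifold 𝓘(ℝ, E) 1 M]
  [IsContinuousRiemannianBundle E (fun x : M => TangentSpace 𝓘(ℝ, E) x)]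

theorem eventually_norm_chart_sub_le [IsRiemannianManifold 𝓘(ℝ, E) M]
    (hχ : χ ∈ IsManifold.maximalAtlas 𝓘(ℝ, E) 1 M) (hp : p ∈ χ.source) :
    ∃ U ∈ 𝓝 p, ∀ᶠ K : ℝ in atTop, ∀ x ∈ U, ∀ y, edist y x < ENNReal.ofReal K⁻¹ →
      y ∈ χ.source ∧ ‖χ y - χ x‖ ≤ K * (edist y x).toReal := by
  obtain ⟨C, hC⟩ := exists_eventually_enorm_chartDeriv_le hχ hp
  obtain ⟨δ, hδ, hball⟩ := EMetric.mem_nhds_iff.1 (inter_mem (χ.open_source.mem_nhds hp) hC)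
  have hlim : Tendsto (fun K : ℝ => ENNReal.ofReal K⁻¹) atTop (𝓝 0) := by
    simpa using ENNReal.tendsto_ofReal tendsto_inv_atTop_zero
  refine ⟨Metric.eball p (δ / 2), Metric.eball_mem_nhds _ (ENNReal.half_pos hδ.ne'), ?_⟩
  filter_upwards [eventually_ge_atTop (C : ℝ),
    hlim.eventually (gt_mem_nhds (ENNReal.half_pos hδ.ne'))] with K hK hKδ x hx y hxy
  have hsub : Metric.eball x (δ / 2) ⊆ Metric.eball p δ := fun z hz =>
    calc edist z p ≤ edist z x + edist x p := edist_triangle _ _ _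
      _ < δ / 2 + δ / 2 := ENNReal.add_lt_add hz hx
      _ = δ := ENNReal.add_halves δ
  have hyx : edist y x < δ / 2 := hxy.trans hKδ
  refine ⟨(hball (hsub hyx)).1, ?_⟩
  have hle := edist_chart_le_mul_edist hχ (fun z hz => (hball (hsub hz)).1)
    (fun z hz => (hball (hsub hz)).2) (edist_comm y x ▸ hyx)
  rw [edist_comm, edist_comm x, edist_eq_enorm_sub] at hle
  have hreal := ENNReal.toReal_mono (ENNReal.mul_ne_top ENNReal.coe_ne_top hxy.ne_top) hle
  rw [ENNReal.toReal_mul, toReal_enorm] at hreal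
  exact hreal.trans (by gcongr; exact hK)

end ChartLipschitz

section ChartConj

theorem mapsTo_of_eq_off {X : Type*} {S T : Set X} {e : X ≃ X} (he : ∀ w ∉ S, e w = w)
    (hS : S ⊆ T) : MapsTo e T T := by
  intro w hw
  by_cases h : e w ∈ S
  · exact hS h
  · rwa [e.injective (he _ h)]

variable {E : Type*} [NormedAddCommGroup E] {M : Type*} [TopologicalSpace M]

open Classical in
/-- The self-map of `M` that is `τ` in the chart `χ` and the identity off the chart domain; it is
meant for maps `τ` that are the identity off a compact subset of the chart target. -/
def chartConj (χ : OpenPartialHomeomorph M E) (τ : E → E) (x : M) : M :=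
  if x ∈ χ.source then χ.symm (τ (χ x)) else x

variable {χ : OpenPartialHomeomorph M E} {τ : E → E} {S : Set E} {x : M}

theorem chartConj_of_mem (hx : x ∈ χ.source) : chartConj χ τ x = χ.symm (τ (χ x)) := if_pos hx

theorem chartConj_of_notMem_source (hx : x ∉ χ.source) : chartConj χ τ x = x := if_neg hx

theorem chartConj_of_notMem_image (hτ : ∀ w ∉ S, τ w = w) (hx : x ∉ χ.symm '' S) :
    chartConj χ τ x = x := by
  by_cases h : x ∈ χ.source
  · rw [chartConj_of_mem h, hτ, χ.left_inv h]
    exact fun hS' => hx ⟨χ x, hS', χ.left_inv h⟩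
  · exact chartConj_of_notMem_source h

theorem chartConj_symm_chartConj {e : E ≃ E} (he : MapsTo e χ.target χ.target) (x : M) :
    chartConj χ e.symm (chartConj χ e x) = x := by
  by_cases hx : x ∈ χ.source
  · have hex := he (χ.map_source hx)
    rw [chartConj_of_mem hx, chartConj_of_mem (χ.map_target hex), χ.right_inv hex,
      e.symm_apply_apply, χ.left_inv hx]
  · rw [chartConj_of_notMem_source hx, chartConj_of_notMem_source hx]

theorem notMem_symm_image (hS : S ⊆ χ.target) (hx : x ∉ χ.source) : x ∉ χ.symm '' S := by
  rintro ⟨w, hw, rfl⟩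
  exact hx (χ.map_target (hS hw))

theorem isCompact_symm_image (hc : IsCompact S) (hS : S ⊆ χ.target) : IsCompact (χ.symm '' S) :=
  hc.image_of_continuousOn (χ.continuousOn_symm.mono hS)

variable [NormedSpace ℝ E] [ChartedSpace E M] [T2Space M] {n : ℕ∞ω}

theorem contMDiff_chartConj (hχ : χ ∈ IsManifold.maximalAtlas 𝓘(ℝ, E) n M) (hτn : ContDiff ℝ n τ)
    (hτ : ∀ w ∉ S, τ w = w) (hc : IsCompact S) (hS : S ⊆ χ.target)
    (hm : MapsTo τ χ.target χ.target) : ContMDiff 𝓘(ℝ, E) 𝓘(ℝ, E) n (chartConj χ τ) := by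
  intro x
  by_cases hx : x ∈ χ.source
  · have hsymm : ContMDiffAt 𝓘(ℝ, E) 𝓘(ℝ, E) n χ.symm (τ (χ x)) :=
      contMDiffAt_symm_of_mem_maximalAtlas hχ (hm (χ.map_source hx))
    refine ((hsymm.comp (χ x) hτn.contMDiff.contMDiffAt).comp x
      (contMDiffAt_of_mem_maximalAtlas hχ hx)).congr_of_eventuallyEq ?_
    filter_upwards [χ.open_source.mem_nhds hx] with y hy
    exact chartConj_of_mem hy
  · refine contMDiffAt_id.congr_of_eventuallyEq ?_
    filter_upwards [(isCompact_symm_image hc hS).isClosed.isOpen_compl.mem_nhds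
      (notMem_symm_image hS hx)] with y hy
    exact chartConj_of_notMem_image hτ hy

theorem exists_diffeomorph_chartConj (hχ : χ ∈ IsManifold.maximalAtlas 𝓘(ℝ, E) n M)
    (Φ : E ≃ₘ^n⟮𝓘(ℝ, E), 𝓘(ℝ, E)⟯ E) (hΦ : ∀ w ∉ S, Φ w = w) (hc : IsCompact S)
    (hS : S ⊆ χ.target) : ∃ Ψ : M ≃ₘ^n⟮𝓘(ℝ, E), 𝓘(ℝ, E)⟯ M, ⇑Ψ = chartConj χ Φ := by
  have hΦsymm (w : E) (hw : w ∉ S) : Φ.toEquiv.symm w = w :=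
    (Equiv.symm_apply_eq _).2 (hΦ w hw).symm
  have hmaps : MapsTo Φ.toEquiv χ.target χ.target := mapsTo_of_eq_off hΦ hS
  have hmaps_symm : MapsTo Φ.toEquiv.symm χ.target χ.target := mapsTo_of_eq_off hΦsymm hS
  exact ⟨{ toFun := chartConj χ Φ.toEquiv
           invFun := chartConj χ Φ.toEquiv.symm
           left_inv := chartConj_symm_chartConj hmaps
           right_inv := chartConj_symm_chartConj hmaps_symm
           contMDiff_toFun := contMDiff_chartConj hχ Φ.contDiff hΦ hc hS hmaps
           contMDiff_invFun := contMDiff_chartConj hχ Φ.symm.contDiff hΦsymm hc hS hmaps_symm },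
    rfl⟩

end ChartConj

section Transition

variable {E : Type*} [NormedAddCommGroup E] [NormedSpace ℝ E] {M : Type*} [TopologicalSpace M]
  {χ χ' : OpenPartialHomeomorph M E} {n : ℕ∞ω} {x : M}

theorem contDiffAt_transition (h : χ.symm.trans χ' ∈ contDiffGroupoid n 𝓘(ℝ, E))
    (hx : x ∈ χ.source) (hx' : x ∈ χ'.source) : ContDiffAt ℝ n (χ' ∘ χ.symm) (χ x) := by
  have hon : ContDiffOn ℝ n (χ' ∘ χ.symm) (χ.symm.trans χ').source :=
    contMDiffOn_iff_contDiffOn.1 (contMDiffOn_of_mem_contDiffGroupoid h)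
  exact hon.contDiffAt ((χ.symm.trans χ').open_source.mem_nhds
    (by simp [hx, hx']))

theorem symm_trans_mem_contDiffGroupoid (h : χ.symm.trans χ' ∈ contDiffGroupoid n 𝓘(ℝ, E)) :
    χ'.symm.trans χ ∈ contDiffGroupoid n 𝓘(ℝ, E) := by
  simpa only [OpenPartialHomeomorph.trans_symm_eq_symm_trans_symm,
    OpenPartialHomeomorph.symm_symm] using (contDiffGroupoid n 𝓘(ℝ, E)).symm h

end Transition

section ChartField

variable {E : Type*} [NormedAddCommGroup E] [NormedSpace ℝ E] {M : Type*} [TopologicalSpace M]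

/-- A vector field on `M` supported in the domain of the chart `χ`, given by its representative in
the chart, which is smooth and compactly supported in the chart target. It is the direction in
which self-maps of `M` are perturbed. -/
structure ChartField (χ : OpenPartialHomeomorph M E) where
  toFun : E → E
  contDiff : ContDiff ℝ ∞ toFun
  hasCompactSupport : HasCompactSupport toFun
  tsupport_subset : tsupport toFun ⊆ χ.target

namespace ChartField

variable {χ χ' : OpenPartialHomeomorph M E} {x q : M} {ε : ℝ}

instance : CoeFun (ChartField χ) fun _ => E → E := ⟨toFun⟩

variable (W : ChartField χ)

/-- The support on `M`. -/
def support : Set M := χ.symm '' tsupport W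

/-- The displacement of the points of `M` by `ε • W` in the chart `χ`. -/
def perturb (ε : ℝ) : M → M := chartConj χ fun w => w + ε • W w

/-- The displacement by `ε • W`, read in the chart `χ'` as a function of `ε` and of the point. -/
def chartRep (χ' : OpenPartialHomeomorph M E) (q : ℝ × E) : E := χ' (W.perturb q.1 (χ'.symm q.2))

theorem add_smul_of_notMem {w : E} (hw : w ∉ tsupport W) : w + ε • W w = w := by
  rw [image_eq_zero_of_notMem_tsupport hw, smul_zero, add_zero]

theorem perturb_of_mem (hx : x ∈ χ.source) : W.perturb ε x = χ.symm (χ x + ε • W (χ x)) :=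
  chartConj_of_mem hx

theorem perturb_of_notMem_support (hx : x ∉ W.support) : W.perturb ε x = x :=
  chartConj_of_notMem_image (fun _ hw => W.add_smul_of_notMem hw) hx

theorem perturb_zero (x : M) : W.perturb 0 x = x := by
  by_cases hx : x ∈ χ.source
  · rw [W.perturb_of_mem hx, zero_smul, add_zero, χ.left_inv hx]
  · exact chartConj_of_notMem_source hx

theorem chartRep_chart (hx : x ∈ χ'.source) :
    W.chartRep χ' (ε, χ' x) = χ' (W.perturb ε x) := by
  simp only [chartRep, χ'.left_inv hx]

theorem chartRep_zero {w : E} (hw : w ∈ χ'.target) : W.chartRep χ' (0, w) = w := by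
  simp only [chartRep, W.perturb_zero, χ'.right_inv hw]

theorem isCompact_support : IsCompact W.support :=
  isCompact_symm_image W.hasCompactSupport W.tsupport_subset

theorem eventually_exists_diffeomorph_perturb [FiniteDimensional ℝ E] [ChartedSpace E M]
    [T2Space M] {r : ℕ} (hr : r ≠ 0) (hχ : χ ∈ IsManifold.maximalAtlas 𝓘(ℝ, E) r M) :
    ∀ᶠ ε in 𝓝 (0 : ℝ), ∃ Ψ : M ≃ₘ^r⟮𝓘(ℝ, E), 𝓘(ℝ, E)⟯ M, ⇑Ψ = W.perturb ε := by
  have : CompleteSpace E := FiniteDimensional.complete ℝ E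
  obtain ⟨L, hL⟩ := (W.contDiff.of_le (m := 1) (by simp)).lipschitzWith_of_hasCompactSupport
    W.hasCompactSupport (by simp)
  have hsmall : ∀ᶠ ε in 𝓝 (0 : ℝ), ‖ε‖₊ * L < 1 :=
    (by fun_prop : Continuous fun ε : ℝ => ‖ε‖₊ * L).continuousAt.eventually
      (gt_mem_nhds (by simp))
  filter_upwards [hsmall] with ε hε
  obtain ⟨Φ, hΦ⟩ := exists_diffeomorph_id_add (n := r) (g := fun w => ε • W w)
    (by exact_mod_cast hr) (contDiff_const.smul (W.contDiff.of_le (by exact_mod_cast le_top)))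
    ((lipschitzWith_smul ε).comp hL) hε
  obtain ⟨Ψ, hΨ⟩ := exists_diffeomorph_chartConj hχ Φ
    (fun w hw => (hΦ w).trans (W.add_smul_of_notMem hw)) W.hasCompactSupport W.tsupport_subset
  exact ⟨Ψ, hΨ.trans (congrArg _ (funext hΦ))⟩

variable [T2Space M]

theorem compl_support_mem_nhds (hq : q ∉ W.support) : W.supportᶜ ∈ 𝓝 q :=
  W.isCompact_support.isClosed.isOpen_compl.mem_nhds hq

theorem eventually_perturb_eq (hq : q ∉ χ.source) : ∀ᶠ y in 𝓝 q, ∀ ε, W.perturb ε y = y := by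
  filter_upwards [W.compl_support_mem_nhds (notMem_symm_image W.tsupport_subset hq)] with y hy ε
  exact W.perturb_of_notMem_support hy

theorem continuousAt_perturb : ContinuousAt (Function.uncurry W.perturb) (0, q) := by
  by_cases hq : q ∈ χ.source
  · have hχ : ContinuousAt (fun p : ℝ × M => χ p.2) (0, q) :=
      (χ.continuousAt hq).comp continuousAt_snd
    have hdisp : ContinuousAt (fun p : ℝ × M => χ p.2 + p.1 • W (χ p.2)) (0, q) :=
      hχ.add (continuousAt_fst.smul (W.contDiff.continuous.continuousAt.comp hχ))
    refine ContinuousAt.congr (f := fun p : ℝ × M => χ.symm (χ p.2 + p.1 • W (χ p.2))) ?_ ?_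
    · refine ContinuousAt.comp (g := χ.symm) ?_ hdisp
      simpa using χ.continuousAt_symm (χ.map_source hq)
    · filter_upwards [continuousAt_snd.eventually (χ.open_source.mem_nhds hq)] with p hp
      exact (W.perturb_of_mem hp).symm
  · refine continuousAt_snd.congr ?_
    filter_upwards [continuousAt_snd.eventually (W.eventually_perturb_eq hq)] with p hp
    exact (hp p.1).symm

theorem contDiffAt_chartRep {n : ℕ} (hχ : χ.symm.trans χ' ∈ contDiffGroupoid n 𝓘(ℝ, E))
    (hq : q ∈ χ'.source) : ContDiffAt ℝ n (W.chartRep χ') (0, χ' q) := by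
  have hsymm : ContinuousAt (fun p : ℝ × E => χ'.symm p.2) (0, χ' q) :=
    ContinuousAt.comp (g := χ'.symm) (χ'.continuousAt_symm (χ'.map_source hq)) continuousAt_snd
  rw [ContinuousAt, χ'.left_inv hq] at hsymm
  by_cases hqχ : q ∈ χ.source
  · have htrans : ContDiffAt ℝ n (fun p : ℝ × E => (χ ∘ χ'.symm) p.2) (0, χ' q) :=
      ContDiffAt.comp (g := χ ∘ χ'.symm) ((0 : ℝ), χ' q)
        (contDiffAt_transition (symm_trans_mem_contDiffGroupoid hχ) hq hqχ) contDiffAt_snd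
    have hdisp : ContDiffAt ℝ n
        (fun p : ℝ × E => (χ ∘ χ'.symm) p.2 + p.1 • W ((χ ∘ χ'.symm) p.2)) (0, χ' q) :=
      htrans.add (contDiffAt_fst.smul
        ((W.contDiff.of_le (by exact_mod_cast le_top)).contDiffAt.comp _ htrans))
    refine ContDiffAt.congr_of_eventuallyEq (ContDiffAt.comp (g := χ' ∘ χ.symm) _ ?_ hdisp) ?_
    · simpa [χ'.left_inv hq] using contDiffAt_transition hχ hqχ hq
    · filter_upwards [hsymm.eventually (χ.open_source.mem_nhds hqχ)] with p hp
      exact congrArg χ' (W.perturb_of_mem hp)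
  · refine contDiffAt_snd.congr_of_eventuallyEq ?_
    filter_upwards [hsymm.eventually (W.eventually_perturb_eq hqχ),
      continuousAt_snd.eventually (χ'.open_target.mem_nhds (χ'.map_source hq))] with p hp hpt
    exact (congrArg χ' (hp p.1)).trans (χ'.right_inv hpt)

end ChartField

end ChartField

namespace ChartField

section Derivative

variable {E : Type*} [NormedAddCommGroup E] [NormedSpace ℝ E] {M : Type*} [TopologicalSpace M]
  [ChartedSpace E M] {χ χ₂ : OpenPartialHomeomorph M E} (W : ChartField χ) {q : M}

open Classical in
/-- The tangent vectors `W` of the points of `M`. -/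
def field (q : M) : TangentSpace 𝓘(ℝ, E) q :=
  if q ∈ χ.source then (chartDeriv χ q).inverse (W (χ q)) else 0

variable (hχ : χ ∈ IsManifold.maximalAtlas 𝓘(ℝ, E) 1 M)
  (hχ₂ : χ₂ ∈ IsManifold.maximalAtlas 𝓘(ℝ, E) 1 M)
include hχ

theorem chartDeriv_field (hq : q ∈ χ.source) : chartDeriv χ q (W.field q) = W (χ q) := by
  rw [field, if_pos hq]
  exact (isInvertible_chartDeriv hχ hq).self_apply_inverse _

variable [T2Space M]
include hχ₂

theorem hasDerivAt_chartRep (hq : q ∈ χ₂.source) :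
    HasDerivAt (fun ε => W.chartRep χ₂ (ε, χ₂ q)) (chartDeriv χ₂ q (W.field q)) 0 := by
  simp only [W.chartRep_chart hq]
  by_cases hqχ : q ∈ χ.source
  · have hline : HasDerivAt (fun ε : ℝ => χ q + ε • W (χ q)) (W (χ q)) 0 := by
      simpa using ((hasDerivAt_id (0 : ℝ)).smul_const (W (χ q))).const_add (χ q)
    have htrans : DifferentiableAt ℝ (χ₂ ∘ χ.symm) (χ q) :=
      (contDiffAt_chart_comp hχ hχ₂ contMDiffAt_id hqχ hq).differentiableAt one_ne_zero
    have hcomp := HasFDerivAt.comp_hasDerivAt_of_eq (0 : ℝ) htrans.hasFDerivAt hline (by simp)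
    rw [← W.chartDeriv_field hχ hqχ, fderiv_transition_chartDeriv hχ hχ₂ hqχ hq] at hcomp
    exact hcomp.congr_of_eventuallyEq
      (.of_forall fun ε => congrArg χ₂ (by rw [W.perturb_of_mem hqχ, W.chartDeriv_field hχ hqχ]))
  · have hconst (ε : ℝ) : W.perturb ε q = q := (W.eventually_perturb_eq hqχ).self_of_nhds ε
    simpa only [field, if_neg hqχ, map_zero, hconst] using hasDerivAt_const (0 : ℝ) (χ₂ q)

theorem fderiv_chartRep (hq : q ∈ χ₂.source) (s : ℝ) (v : E) :
    fderiv ℝ (W.chartRep χ₂) (0, χ₂ q) (s, v) = v + s • chartDeriv χ₂ q (W.field q) := by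
  have hd : DifferentiableAt ℝ (W.chartRep χ₂) (0, χ₂ q) :=
    (W.contDiffAt_chartRep (n := 1) (StructureGroupoid.compatible_of_mem_maximalAtlas hχ hχ₂)
      hq).differentiableAt (by simp)
  have hspace : fderiv ℝ (W.chartRep χ₂) (0, χ₂ q) (0, v) = v := by
    have hslice : HasFDerivAt (fun w => W.chartRep χ₂ (0, w)) (.id ℝ E) (χ₂ q) :=
      (hasFDerivAt_id _).congr_of_eventuallyEq (by
        filter_upwards [χ₂.open_target.mem_nhds (χ₂.map_source hq)] with w hw
        exact W.chartRep_zero hw)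
    exact congrArg (fun L => L v)
      ((hd.hasFDerivAt.comp (χ₂ q) (hasFDerivAt_prodMk_right 0 (χ₂ q))).unique hslice)
  have htime : fderiv ℝ (W.chartRep χ₂) (0, χ₂ q) (1, 0) = chartDeriv χ₂ q (W.field q) :=
    (HasFDerivAt.comp_hasDerivAt (f := fun ε : ℝ => (ε, χ₂ q)) 0 hd.hasFDerivAt
      ((hasDerivAt_id 0).prodMk (hasDerivAt_const 0 _))).unique (W.hasDerivAt_chartRep hχ hχ₂ hq)
  have hsv : ((s, v) : ℝ × E) = (0, v) + s • (1, 0) := by simp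
  rw [hsv, map_add, map_smul, hspace, htime]

end Derivative

section Composition

variable {E : Type*} [NormedAddCommGroup E] [NormedSpace ℝ E] {M : Type*} [TopologicalSpace M]
  {χ χ₁ χ₂ : OpenPartialHomeomorph M E} (W : ChartField χ) {f : M → M} {p x : M} {r : ℕ}

theorem perturb_comp_eventuallyEq (hf : ContinuousAt f x) (hx : x ∈ χ₁.source)
    (hfx : f x ∈ χ₂.source) (ε : ℝ) : χ₂ ∘ (W.perturb ε ∘ f) ∘ χ₁.symm =ᶠ[𝓝 (χ₁ x)]
      (fun w => W.chartRep χ₂ (ε, w)) ∘ χ₂ ∘ f ∘ χ₁.symm := by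
  have hread : Tendsto (f ∘ χ₁.symm) (𝓝 (χ₁ x)) (𝓝 (f x)) :=
    hf.tendsto.comp (χ₁.tendsto_symm hx)
  filter_upwards [hread.eventually (χ₂.open_source.mem_nhds hfx)] with w hw
  exact (W.chartRep_chart hw).symm

variable [T2Space M]

theorem perturb_comp_eventuallyEq_of_notMem_support (hf : ContinuousAt f x) (hx : x ∈ χ₁.source)
    (hfx : f x ∉ W.support) (ε : ℝ) :
    χ₂ ∘ (W.perturb ε ∘ f) ∘ χ₁.symm =ᶠ[𝓝 (χ₁ x)] χ₂ ∘ f ∘ χ₁.symm := by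
  have hread : Tendsto (f ∘ χ₁.symm) (𝓝 (χ₁ x)) (𝓝 (f x)) :=
    hf.tendsto.comp (χ₁.tendsto_symm hx)
  filter_upwards [hread.eventually (W.compl_support_mem_nhds hfx)] with w hw
  exact congrArg χ₂ (W.perturb_of_notMem_support hw)

variable [ChartedSpace E M]

theorem isBigO_iteratedFDeriv_perturb_comp_sub
    (hχ : χ.symm.trans χ₂ ∈ contDiffGroupoid ((r + 1 : ℕ) : ℕ∞ω) 𝓘(ℝ, E))
    (hχ₁ : χ₁ ∈ IsManifold.maximalAtlas 𝓘(ℝ, E) r M)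
    (hχ₂ : χ₂ ∈ IsManifold.maximalAtlas 𝓘(ℝ, E) r M)
    (hf : ContMDiff 𝓘(ℝ, E) 𝓘(ℝ, E) r f) (hp : p ∈ χ₁.source) (hfp : f p ∈ χ₂.source)
    {k : ℕ} (hk : k ≤ r) :
    (fun q : ℝ × M => iteratedFDeriv ℝ k (χ₂ ∘ (W.perturb q.1 ∘ f) ∘ χ₁.symm) (χ₁ q.2) -
      iteratedFDeriv ℝ k (χ₂ ∘ f ∘ χ₁.symm) (χ₁ q.2)) =O[𝓝 (0, p)] Prod.fst := by
  have hchart : ContinuousAt (fun q : ℝ × M => (q.1, χ₁ q.2)) (0, p) :=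
    continuousAt_fst.prodMk (ContinuousAt.comp (χ₁.continuousAt hp) continuousAt_snd)
  have hrep : ContDiffAt ℝ r (χ₂ ∘ f ∘ χ₁.symm) (χ₁ p) :=
    contDiffAt_chart_comp hχ₁ hχ₂ hf.contMDiffAt hp hfp
  have hrepp : (χ₂ ∘ f ∘ χ₁.symm) (χ₁ p) = χ₂ (f p) := by simp [χ₁.left_inv hp]
  have hW : ContDiffAt ℝ ((r + 1 : ℕ) : ℕ∞ω) (W.chartRep χ₂) (0, (χ₂ ∘ f ∘ χ₁.symm) (χ₁ p)) :=
    hrepp ▸ W.contDiffAt_chartRep hχ hfp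
  have hzero : (fun w => W.chartRep χ₂ (0, w) - w) =ᶠ[𝓝 ((χ₂ ∘ f ∘ χ₁.symm) (χ₁ p))] 0 := by
    rw [hrepp]
    filter_upwards [χ₂.open_target.mem_nhds (χ₂.map_source hfp)] with w hw
    rw [W.chartRep_zero hw, sub_self, Pi.zero_apply]
  refine ((isBigO_iteratedFDeriv_comp_fst (f := fun ε w => W.chartRep χ₂ (ε, w) - w) hk
    (hW.sub contDiffAt_snd) hzero hrep).comp_tendsto hchart).congr' ?_ .rfl
  have hcont : ContinuousAt (fun q : ℝ × E => (q.1, (χ₂ ∘ f ∘ χ₁.symm) q.2)) (0, χ₁ p) :=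
    continuousAt_fst.prodMk (ContinuousAt.comp (g := χ₂ ∘ f ∘ χ₁.symm) (f := Prod.snd)
      hrep.continuousAt continuousAt_snd)
  filter_upwards [hchart.eventually (hcont.eventually (hW.eventually (by simp))),
    continuousAt_snd.eventually (χ₁.open_source.mem_nhds hp),
    continuousAt_snd.eventually (hf.continuous.continuousAt.eventually
      (χ₂.open_source.mem_nhds hfp))] with q hWq hq hfq
  have hkr : (k : ℕ∞ω) ≤ r := by exact_mod_cast hk
  have hrepq : ContDiffAt ℝ k (χ₂ ∘ f ∘ χ₁.symm) (χ₁ q.2) :=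
    (contDiffAt_chart_comp hχ₁ hχ₂ hf.contMDiffAt hq hfq).of_le hkr
  have hslice : ContDiffAt ℝ k (fun w => W.chartRep χ₂ (q.1, w))
      ((χ₂ ∘ f ∘ χ₁.symm) (χ₁ q.2)) :=
    (hWq.of_le (by exact_mod_cast hk.trans r.le_succ)).comp _ (f := fun w => (q.1, w))
      (by fun_prop)
  rw [((W.perturb_comp_eventuallyEq hf.continuous.continuousAt hq hfq q.1).iteratedFDeriv
    ℝ k).eq_of_nhds]
  exact iteratedFDeriv_sub_apply (hslice.comp _ hrepq) hrepq

end Composition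

end ChartField

theorem eventually_forall_of_locallyFinite {X ι α : Type*} [TopologicalSpace X] {K : ι → Set X}
    (hK : LocallyFinite K) {S : Set X} (hS : IsCompact S) {l : Filter α} {P : α → ι → Prop}
    (hmeet : ∀ i, (K i ∩ S).Nonempty → ∀ᶠ a in l, P a i)
    (hdisj : ∀ i, Disjoint (K i) S → ∀ a, P a i) : ∀ᶠ a in l, ∀ i, P a i := by
  filter_upwards [(eventually_all_finite (hK.finite_nonempty_inter_compact hS)).2 hmeet]
    with a ha i
  exact (K i ∩ S).eq_empty_or_nonempty.elim
    (fun h => hdisj i (disjoint_iff_inter_eq_empty.2 h) a) (ha i)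

namespace CrGauge

variable {E : Type*} [NormedAddCommGroup E] [NormedSpace ℝ E]
  {M : Type*} [TopologicalSpace M] [T2Space M] [ChartedSpace E M] {r : ℕ}
  (A : CrGauge E M r) {f : M ≃ₘ^r⟮𝓘(ℝ, E), 𝓘(ℝ, E)⟯ M} (hf : A.Adapted f)
include hf

theorem eventually_adapted_perturb_comp {χ : OpenPartialHomeomorph M E} (W : ChartField χ) :
    ∀ᶠ ε in 𝓝 (0 : ℝ), A.Adapted (W.perturb ε ∘ f) := by
  have hcompact : IsCompact (f ⁻¹' W.support) :=
    f.toHomeomorph.isCompact_preimage.2 W.isCompact_support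
  refine eventually_forall_of_locallyFinite A.locallyFinite_K hcompact (fun i _ => ?_)
    fun i hi ε x hx => ?_
  · refine (A.isCompact_K i).eventually_forall_of_forall_eventually fun x hx => ?_
    have hcont : ContinuousAt (fun q : ℝ × M => W.perturb q.1 (f q.2)) (0, x) :=
      ContinuousAt.comp (g := Function.uncurry W.perturb) (f := fun q : ℝ × M => (q.1, f q.2))
        W.continuousAt_perturb (continuousAt_fst.prodMk
          (f.continuous.continuousAt.comp continuousAt_snd))
    refine hcont.eventually ((A.χ (A.t i)).open_source.mem_nhds ?_)
    simpa only [W.perturb_zero] using hf i hx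
  · rw [Function.comp_apply, W.perturb_of_notMem_support (hi.notMem_of_mem_left hx)]
    exact hf i hx

theorem isBigO_iteratedFDeriv_local_rep_sub {j : ℕ} (W : ChartField (A.χ j)) (i : ℕ) {k : ℕ}
    (hk : k ≤ r) :
    (fun q : ℝ × M => iteratedFDeriv ℝ k (A.local_rep (W.perturb q.1 ∘ f) i) (A.χ i q.2) -
      iteratedFDeriv ℝ k (A.local_rep f i) (A.χ i q.2)) =O[𝓝 0 ×ˢ 𝓟 (A.K i)] Prod.fst := by
  refine isBigO_prod_principal_of_isCompact (A.isCompact_K i) fun p hp =>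
    (W.isBigO_iteratedFDeriv_perturb_comp_sub (A.χ_compat j (A.t i)) (A.χ_mem i)
      (A.χ_mem (A.t i)) f.contMDiff (A.K_subset i hp) (hf i hp) hk).mono ?_
  rw [nhds_prod_eq]
  exact prod_mono le_rfl nhdsWithin_le_nhds

theorem eventually_edist_local_rep_perturb_comp_le {j : ℕ} (W : ChartField (A.χ j)) (i : ℕ) :
    ∀ᶠ D : ℝ in atTop, ∀ᶠ ε in 𝓝 (0 : ℝ), ∀ k ≤ r, ∀ x ∈ A.K i,
      A.w i * edist (iteratedFDeriv ℝ k (A.local_rep f i) (A.χ i x))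
        (iteratedFDeriv ℝ k (A.local_rep (W.perturb ε ∘ f) i) (A.χ i x)) ≤
          ENNReal.ofReal (D * |ε|) := by
  have hk : ∀ k ∈ Iic r, ∀ᶠ D : ℝ in atTop, ∀ᶠ ε in 𝓝 (0 : ℝ), ∀ x ∈ A.K i,
      ‖iteratedFDeriv ℝ k (A.local_rep (W.perturb ε ∘ f) i) (A.χ i x) -
        iteratedFDeriv ℝ k (A.local_rep f i) (A.χ i x)‖ ≤ D * ‖ε‖ := fun k hk =>
    (Asymptotics.isBigO_iff_eventually.1
      (A.isBigO_iteratedFDeriv_local_rep_sub hf W i hk)).mono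
        fun D hD => eventually_prod_principal_iff.1 hD
  have hscale : Tendsto (fun D : ℝ => D / A.w i) atTop atTop :=
    tendsto_id.atTop_div_const (A.w_pos i)
  filter_upwards [hscale.eventually ((eventually_all_finite (finite_Iic r)).2 hk)] with D hD
  filter_upwards [(eventually_all_finite (finite_Iic r)).2 hD] with ε hε k hk x hx
  have hw : (0 : ℝ) < A.w i := A.w_pos i
  rw [edist_comm, edist_eq_enorm_sub, ← ofReal_norm, ← ENNReal.ofReal_coe_nnreal,
    ← ENNReal.ofReal_mul hw.le]
  refine ENNReal.ofReal_le_ofReal ((mul_le_mul_of_nonneg_left (hε k hk x hx) hw.le).trans_eq ?_)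
  rw [Real.norm_eq_abs]
  field_simp

theorem exists_eventually_crDist_perturb_comp_le {j : ℕ} (W : ChartField (A.χ j)) :
    ∃ D : ℝ, ∀ᶠ ε in 𝓝 0, A.crDist f (W.perturb ε ∘ f) ≤ ENNReal.ofReal (D * |ε|) := by
  have hcompact : IsCompact (f ⁻¹' W.support) :=
    f.toHomeomorph.isCompact_preimage.2 W.isCompact_support
  have hdisj (i : ℕ) (hi : Disjoint (A.K i) (f ⁻¹' W.support)) (D ε : ℝ) :
      ∀ k ≤ r, ∀ x ∈ A.K i,
        A.w i * edist (iteratedFDeriv ℝ k (A.local_rep f i) (A.χ i x))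
          (iteratedFDeriv ℝ k (A.local_rep (W.perturb ε ∘ f) i) (A.χ i x)) ≤
            ENNReal.ofReal (D * |ε|) := by
    intro k _ x hx
    have hfx : f x ∉ W.support := hi.notMem_of_mem_left hx
    have hloc : A.local_rep (W.perturb ε ∘ f) i =ᶠ[𝓝 (A.χ i x)] A.local_rep f i :=
      W.perturb_comp_eventuallyEq_of_notMem_support f.continuous.continuousAt
        (A.K_subset i hx) hfx ε
    rw [(hloc.iteratedFDeriv ℝ k).eq_of_nhds, edist_self, mul_zero]
    exact zero_le
  obtain ⟨D, hD⟩ := (eventually_forall_of_locallyFinite A.locallyFinite_K hcompact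
    (fun i _ => A.eventually_edist_local_rep_perturb_comp_le hf W i)
    fun i hi D => .of_forall fun ε => hdisj i hi D ε).exists
  refine ⟨D, (eventually_forall_of_locallyFinite A.locallyFinite_K hcompact
    (fun i _ => hD i) fun i hi ε => hdisj i hi D ε).mono fun ε hε => ?_⟩
  simp only [crDist, iSup_le_iff]
  exact hε

end CrGauge

section Bundles

variable {E : Type*} [NormedAddCommGroup E] [NormedSpace ℝ E]
  {M : Type*} [TopologicalSpace M] [ChartedSpace E M] {Λ : Set M}
  {F G : ∀ x : M, Submodule ℝ (TangentSpace 𝓘(ℝ, E) x)} {X : ∀ x : M, TangentSpace 𝓘(ℝ, E) x}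
  {r : ℕ} {f : M ≃ₘ^r⟮𝓘(ℝ, E), 𝓘(ℝ, E)⟯ M}

theorem IsDInvariant.sup (hF : IsDInvariant f Λ F) (hG : IsDInvariant f Λ G) :
    IsDInvariant f Λ fun x => F x ⊔ G x := fun x hx => by
  rw [Submodule.map_sup, hF x hx, hG x hx]

theorem isDInvariant_span {a : M → ℝ} (ha : ∀ x ∈ Λ, a x ≠ 0)
    (hX : ∀ x ∈ Λ, mfderiv 𝓘(ℝ, E) 𝓘(ℝ, E) f x (X x) = a x • X (f x)) :
    IsDInvariant f Λ fun x => Submodule.span ℝ {X x} := fun x hx => by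
  rw [Submodule.map_span, image_singleton]
  exact (congrArg (fun v => Submodule.span ℝ {v}) (hX x hx)).trans
    (Submodule.span_singleton_smul_eq (IsUnit.mk0 _ (ha x hx)) _)

variable [IsManifold 𝓘(ℝ, E) 1 M]

theorem ContinuousField.mono {S T : Set M} (hX : ContinuousField T X) (hST : S ⊆ T) :
    ContinuousField S X :=
  ContinuousOn.mono hX hST

theorem isSubbundle_span (hX : ContinuousField Λ X) (hX0 : ∀ x ∈ Λ, X x ≠ 0) :
    IsSubbundle Λ fun x => Submodule.span ℝ {X x} := fun x _ =>
  ⟨univ, univ_mem, 1, fun _ => X, fun _ => hX.mono inter_subset_right, fun y hy =>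
    ⟨linearIndependent_unique_iff.2 (hX0 y hy.2), by rw [range_const]⟩⟩

theorem IsSubbundle.sup (hF : IsSubbundle Λ F) (hG : IsSubbundle Λ G)
    (hd : ∀ x ∈ Λ, Disjoint (F x) (G x)) : IsSubbundle Λ fun x => F x ⊔ G x := by
  intro x hx
  obtain ⟨U, hU, k, b, hbc, hb⟩ := hF x hx
  obtain ⟨U', hU', k', b', hbc', hb'⟩ := hG x hx
  refine ⟨U ∩ U', inter_mem hU hU', k + k', Fin.append b b', fun j => ?_, ?_⟩
  · refine Fin.addCases (fun i => ?_) (fun i => ?_) j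
    · rw [Fin.append_left]
      exact (hbc i).mono fun y hy => ⟨hy.1.1, hy.2⟩
    · rw [Fin.append_right]
      exact (hbc' i).mono fun y hy => ⟨hy.1.2, hy.2⟩
  · rintro y ⟨⟨hy, hy'⟩, hyΛ⟩
    obtain ⟨hli, hsp⟩ := hb y ⟨hy, hyΛ⟩
    obtain ⟨hli', hsp'⟩ := hb' y ⟨hy', hyΛ⟩
    have hframe : (fun j => Fin.append b b' j y) ∘ finSumFinEquiv =
        Sum.elim (fun i => b i y) fun i => b' i y := by
      funext i
      rcases i with i | i <;> simp
    constructor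
    · rw [← linearIndependent_equiv finSumFinEquiv, hframe]
      exact hli.sum_type hli' (by rw [hsp, hsp']; exact hd y hyΛ)
    · rw [← EquivLike.range_comp (fun j => Fin.append b b' j y) finSumFinEquiv, hframe,
        Sum.elim_range, Submodule.span_union, hsp, hsp']

end Bundles

section Coordinate

variable {E : Type*} [NormedAddCommGroup E] [NormedSpace ℝ E]

theorem exists_continuousLinearMap_eq_one [FiniteDimensional ℝ E] {W : Submodule ℝ E} {x : E}
    (hx : x ∉ W) : ∃ θ : E →L[ℝ] ℝ, θ x = 1 ∧ ∀ w ∈ W, θ w = 0 := by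
  obtain ⟨g, hg, hW⟩ := W.exists_le_ker_of_notMem hx
  exact ⟨LinearMap.toContinuousLinearMap ((g x)⁻¹ • g), by simp [hg],
    fun w hw => by simp [LinearMap.mem_ker.1 (hW hw)]⟩

variable {M : Type*} [TopologicalSpace M] [ChartedSpace E M] {Λ : Set M}
  {X : ∀ x : M, TangentSpace 𝓘(ℝ, E) x} {H : ∀ x : M, Submodule ℝ (TangentSpace 𝓘(ℝ, E) x)}
  {θ : ∀ x : M, TangentSpace 𝓘(ℝ, E) x →L[ℝ] ℝ}

/-- A field of linear forms along `Λ` is continuous: its expressions in charts are. -/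
def ContinuousForm (Λ : Set M) (θ : ∀ x : M, TangentSpace 𝓘(ℝ, E) x →L[ℝ] ℝ) : Prop :=
  ∀ χ ∈ IsManifold.maximalAtlas 𝓘(ℝ, E) 1 M, ∀ p ∈ Λ, p ∈ χ.source →
    ContinuousWithinAt (chartForm χ θ) Λ p

/-- `θ` is the coordinate along the field `X` over `Λ` for a splitting `span {X} ⊕ H` of the
tangent spaces. -/
structure IsCoordinateAlong (Λ : Set M) (X : ∀ x : M, TangentSpace 𝓘(ℝ, E) x)
    (H : ∀ x : M, Submodule ℝ (TangentSpace 𝓘(ℝ, E) x))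
    (θ : ∀ x : M, TangentSpace 𝓘(ℝ, E) x →L[ℝ] ℝ) : Prop where
  apply_field : ∀ x ∈ Λ, θ x (X x) = 1
  apply_eq_zero : ∀ x ∈ Λ, ∀ v ∈ H x, θ x v = 0

theorem exists_isCoordinateAlong [FiniteDimensional ℝ E] (h : ∀ x ∈ Λ, X x ∉ H x) :
    ∃ θ, IsCoordinateAlong Λ X H θ := by
  have hθ (x : M) : ∃ θ : TangentSpace 𝓘(ℝ, E) x →L[ℝ] ℝ,
      x ∈ Λ → θ (X x) = 1 ∧ ∀ w ∈ H x, θ w = 0 := by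
    by_cases hx : x ∈ Λ
    · exact (exists_continuousLinearMap_eq_one (E := E) (h x hx)).imp fun _ hθ _ => hθ
    · exact ⟨0, fun hx' => absurd hx' hx⟩
  choose θ hθ using hθ
  exact ⟨θ, fun x hx => (hθ x hx).1, fun x hx => (hθ x hx).2⟩

namespace IsCoordinateAlong

variable (hθ : IsCoordinateAlong Λ X H θ)
include hθ

theorem apply_mfderiv {r : ℕ} {f : M ≃ₘ^r⟮𝓘(ℝ, E), 𝓘(ℝ, E)⟯ M} (hH : IsDInvariant f Λ H)
    (hXH : ∀ x ∈ Λ, Submodule.span ℝ {X x} ⊔ H x = ⊤) (hΛ : MapsTo f Λ Λ) {a : M → ℝ}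
    (ha : ∀ x ∈ Λ, mfderiv 𝓘(ℝ, E) 𝓘(ℝ, E) f x (X x) = a x • X (f x)) {x : M} (hx : x ∈ Λ)
    (v : TangentSpace 𝓘(ℝ, E) x) :
    θ (f x) (mfderiv 𝓘(ℝ, E) 𝓘(ℝ, E) f x v) = a x * θ x v := by
  obtain ⟨c, hc, w, hw, rfl⟩ := Submodule.mem_sup.1 (hXH x hx ▸ Submodule.mem_top (x := v))
  obtain ⟨t, rfl⟩ := Submodule.mem_span_singleton.1 hc
  have hw' : θ (f x) (mfderiv 𝓘(ℝ, E) 𝓘(ℝ, E) f x w) = 0 :=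
    hθ.apply_eq_zero _ (hΛ hx) _ (hH x hx ▸ Submodule.mem_map_of_mem hw)
  have hX : θ (f x) (mfderiv 𝓘(ℝ, E) 𝓘(ℝ, E) f x (X x)) = a x := by
    rw [ha x hx, map_smul, hθ.apply_field _ (hΛ hx), smul_eq_mul, mul_one]
  simp only [map_add, map_smul, hw', hX, hθ.apply_field x hx, hθ.apply_eq_zero x hx w hw,
    smul_eq_mul]
  ring

theorem continuousForm [IsManifold 𝓘(ℝ, E) 1 M] (hH : IsSubbundle Λ H)
    (hX : ContinuousField Λ X) (hXH : ∀ x ∈ Λ, Submodule.span ℝ {X x} ⊔ H x = ⊤) :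
    ContinuousForm Λ θ := by
  intro χ hχ p hp hpχ
  obtain ⟨U, hU, k, b, hbc, hb⟩ := hH p hp
  have hpU : p ∈ U ∩ Λ := ⟨mem_of_mem_nhds hU, hp⟩
  obtain ⟨e, he⟩ := isInvertible_chartDeriv hχ hpχ
  let frame (q : M) : Fin (k + 1) → TangentSpace 𝓘(ℝ, E) q := Fin.cons (X q) fun j => b j q
  have hspan : Submodule.span ℝ (range (frame p)) = ⊤ := by
    rw [Fin.range_cons, Submodule.span_insert, (hb p hpU).2, hXH p hp]
  have hli : LinearIndependent ℝ (frame p) := by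
    refine linearIndependent_finCons.2 ⟨(hb p hpU).1, fun hmem => one_ne_zero (α := ℝ) ?_⟩
    rw [← hθ.apply_field p hp, hθ.apply_eq_zero p hp _ ((hb p hpU).2 ▸ hmem)]
  refine continuousWithinAt_of_apply_frame (b := fun i q => chartDeriv χ q (frame q i))
    (c := Fin.cons 1 0) hp (fun i => ?_) ?_ ?_ ?_
  · induction i using Fin.cases with
    | zero => exact hX.chartDeriv hχ hp hpχ
    | succ j =>
      refine ((hbc j).chartDeriv hχ hpU hpχ).mono_of_mem_nhdsWithin ?_
      exact inter_mem (mem_nhdsWithin_of_mem_nhds hU) self_mem_nhdsWithin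
  · exact he ▸ hli.map' e.toLinearMap e.toLinearEquiv.ker
  · change ⊤ ≤ Submodule.span ℝ (range ((chartDeriv χ p).toLinearMap ∘ frame p))
    rw [range_comp, ← Submodule.map_span, hspan, ← he]
    exact (Submodule.map_top _).trans e.toLinearEquiv.range |>.ge
  · filter_upwards [self_mem_nhdsWithin, mem_nhdsWithin_of_mem_nhds hU,
      mem_nhdsWithin_of_mem_nhds (χ.open_source.mem_nhds hpχ)] with q hq hqU hqχ i
    rw [chartForm_chartDeriv hχ hqχ]
    induction i using Fin.cases with
    | zero => exact hθ.apply_field q hq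
    | succ j =>
      exact hθ.apply_eq_zero q hq _ ((hb q ⟨hqU, hq⟩).2 ▸ Submodule.subset_span ⟨j, rfl⟩)

end IsCoordinateAlong

theorem ContinuousForm.exists_bound [IsManifold 𝓘(ℝ, E) 1 M]
    [RiemannianBundle (fun x : M => TangentSpace 𝓘(ℝ, E) x)]
    [IsContinuousRiemannianBundle E (fun x : M => TangentSpace 𝓘(ℝ, E) x)]
    (hθ : ContinuousForm Λ θ) (hΛ : IsCompact Λ) :
    ∃ K : ℝ, ∀ x ∈ Λ, ∀ v : TangentSpace 𝓘(ℝ, E) x, |θ x v| ≤ K * ‖v‖ := by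
  refine (eventually_atTop_forall_of_isCompact hΛ fun p hp => ?_).exists
  have hχ : chartAt E p ∈ IsManifold.maximalAtlas 𝓘(ℝ, E) 1 M :=
    IsManifold.chart_mem_maximalAtlas p
  have hpχ := mem_chart_source E p
  obtain ⟨C, hC⟩ := exists_eventually_enorm_chartDeriv_le hχ hpχ
  have hform := (hθ _ hχ p hp hpχ).norm.eventually (gt_mem_nhds (lt_add_one _))
  refine ⟨_, hform.and (mem_nhdsWithin_of_mem_nhds
    (hC.and ((chartAt E p).open_source.mem_nhds hpχ))), ?_⟩
  filter_upwards [eventually_ge_atTop ((‖chartForm (chartAt E p) θ p‖ + 1) * C)]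
    with K hK x ⟨hxform, hxC, hxχ⟩ v
  have hnorm : ‖chartDeriv (chartAt E p) x v‖ ≤ C * ‖v‖ := by
    have := ENNReal.toReal_mono (by finiteness) (hxC v)
    rwa [ENNReal.toReal_mul, toReal_enorm, toReal_enorm, ENNReal.coe_toReal] at this
  rw [← chartForm_chartDeriv hχ hxχ, ← Real.norm_eq_abs]
  calc _ ≤ ‖chartForm (chartAt E p) θ x‖ * ‖chartDeriv (chartAt E p) x v‖ :=
        ContinuousLinearMap.le_opNorm _ _
    _ ≤ (‖chartForm (chartAt E p) θ p‖ + 1) * (C * ‖v‖) := by gcongr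
    _ = (‖chartForm (chartAt E p) θ p‖ + 1) * C * ‖v‖ := by ring
    _ ≤ K * ‖v‖ := by gcongr

end Coordinate

namespace ChartField

variable {E : Type*} [NormedAddCommGroup E] [NormedSpace ℝ E] {M : Type*} [TopologicalSpace M]
  {χ χ₁ χ₂ : OpenPartialHomeomorph M E} (W : ChartField χ) {f : M → M} {p x : M}

/-- The maps `W.perturb ε ∘ f` read in the charts `χ₁` and `χ₂`, as one map of the pair of `ε` and
the point. -/
def compRep (f : M → M) (χ₁ χ₂ : OpenPartialHomeomorph M E) (q : ℝ × E) : E :=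
  χ₂ (W.perturb q.1 (f (χ₁.symm q.2)))

theorem compRep_eventuallyEq (hf : ContinuousAt f x) (hx : x ∈ χ₁.source) (hfx : f x ∈ χ₂.source)
    (ε : ℝ) : W.compRep f χ₁ χ₂ =ᶠ[𝓝 (ε, χ₁ x)]
      W.chartRep χ₂ ∘ Prod.map id (χ₂ ∘ f ∘ χ₁.symm) := by
  have hread : Tendsto (f ∘ χ₁.symm) (𝓝 (χ₁ x)) (𝓝 (f x)) :=
    hf.tendsto.comp (χ₁.tendsto_symm hx)
  have hsnd : Tendsto Prod.snd (𝓝 (ε, χ₁ x)) (𝓝 (χ₁ x)) := continuousAt_snd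
  filter_upwards [(hread.comp hsnd).eventually (χ₂.open_source.mem_nhds hfx)] with q hq
  exact (W.chartRep_chart hq).symm

variable [ChartedSpace E M] [T2Space M] {n : ℕ}
  (hχ : χ ∈ IsManifold.maximalAtlas 𝓘(ℝ, E) n M)
  (hχ₁ : χ₁ ∈ IsManifold.maximalAtlas 𝓘(ℝ, E) n M)
  (hχ₂ : χ₂ ∈ IsManifold.maximalAtlas 𝓘(ℝ, E) n M)
  (hf : ContMDiff 𝓘(ℝ, E) 𝓘(ℝ, E) n f) (hx : x ∈ χ₁.source) (hfx : f x ∈ χ₂.source)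
include hχ hχ₁ hχ₂ hf hx hfx

theorem contDiffAt_compRep : ContDiffAt ℝ n (W.compRep f χ₁ χ₂) (0, χ₁ x) := by
  have hbase : Prod.map id (χ₂ ∘ f ∘ χ₁.symm) ((0 : ℝ), χ₁ x) = (0, χ₂ (f x)) := by
    simp [χ₁.left_inv hx]
  refine ContDiffAt.congr_of_eventuallyEq (.comp _ ?_ ?_)
    (W.compRep_eventuallyEq hf.continuous.continuousAt hx hfx 0)
  · rw [hbase]
    exact W.contDiffAt_chartRep (StructureGroupoid.compatible_of_mem_maximalAtlas hχ hχ₂) hfx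
  · exact contDiffAt_id.prodMap (contDiffAt_chart_comp hχ₁ hχ₂ hf.contMDiffAt hx hfx)

theorem fderiv_compRep (hn : 1 ≤ n) (s : ℝ) (u : TangentSpace 𝓘(ℝ, E) x) :
    fderiv ℝ (W.compRep f χ₁ χ₂) (0, χ₁ x) (s, chartDeriv χ₁ x u) =
      chartDeriv χ₂ (f x) (mfderiv 𝓘(ℝ, E) 𝓘(ℝ, E) f x u + s • W.field (f x)) := by
  have hn' : (1 : ℕ∞ω) ≤ n := by exact_mod_cast hn
  have hχ' := IsManifold.maximalAtlas_subset_of_le hn' hχ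
  have hχ₁' := IsManifold.maximalAtlas_subset_of_le hn' hχ₁
  have hχ₂' := IsManifold.maximalAtlas_subset_of_le hn' hχ₂
  have hbase : Prod.map id (χ₂ ∘ f ∘ χ₁.symm) ((0 : ℝ), χ₁ x) = (0, χ₂ (f x)) := by
    simp [χ₁.left_inv hx]
  have hrep : DifferentiableAt ℝ (χ₂ ∘ f ∘ χ₁.symm) (χ₁ x) :=
    (contDiffAt_chart_comp hχ₁ hχ₂ hf.contMDiffAt hx hfx).differentiableAt (by positivity)
  have hW : DifferentiableAt ℝ (W.chartRep χ₂)
      (Prod.map id (χ₂ ∘ f ∘ χ₁.symm) ((0 : ℝ), χ₁ x)) := by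
    rw [hbase]
    exact (W.contDiffAt_chartRep (StructureGroupoid.compatible_of_mem_maximalAtlas hχ hχ₂)
      hfx).differentiableAt (by positivity)
  rw [(W.compRep_eventuallyEq hf.continuous.continuousAt hx hfx 0).fderiv_eq,
    fderiv_comp _ hW (differentiableAt_id.prodMap _ hrep), hbase,
    (hasFDerivAt_id (0 : ℝ)).prodMap (0, χ₁ x) hrep.hasFDerivAt |>.fderiv]
  calc _ = fderiv ℝ (χ₂ ∘ f ∘ χ₁.symm) (χ₁ x) (chartDeriv χ₁ x u) +
        s • chartDeriv χ₂ (f x) (W.field (f x)) := W.fderiv_chartRep hχ' hχ₂' hfx s _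
    _ = _ := by
        rw [fderiv_comp_chartDeriv hχ₁' hχ₂' (hf.contMDiffAt.mdifferentiableAt (by positivity)) hx
          hfx, map_add, map_smul]

theorem chartForm_sub_linearization (hn : 1 ≤ n) {θ : ∀ x : M, TangentSpace 𝓘(ℝ, E) x →L[ℝ] ℝ}
    {c : ℝ} (hθ : ∀ v, θ (f x) (mfderiv 𝓘(ℝ, E) 𝓘(ℝ, E) f x v) = c * θ x v) {y : M}
    (hy : y ∈ χ₁.source) (ε : ℝ) :
    chartForm χ₂ θ (f x) (χ₂ (W.perturb ε (f y)) - χ₂ (f x)) -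
        c * chartForm χ₁ θ x (χ₁ y - χ₁ x) - ε * θ (f x) (W.field (f x)) =
      chartForm χ₂ θ (f x) (W.compRep f χ₁ χ₂ (ε, χ₁ y) - W.compRep f χ₁ χ₂ (0, χ₁ x) -
        fderiv ℝ (W.compRep f χ₁ χ₂) (0, χ₁ x) ((ε, χ₁ y) - (0, χ₁ x))) := by
  have hn' : (1 : ℕ∞ω) ≤ n := by exact_mod_cast hn
  have hχ₂' := IsManifold.maximalAtlas_subset_of_le hn' hχ₂
  obtain ⟨u, hu⟩ : ∃ u, chartDeriv χ₁ x u = χ₁ y - χ₁ x :=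
    (isInvertible_chartDeriv (IsManifold.maximalAtlas_subset_of_le hn' hχ₁) hx).bijective.2 _
  have hform : chartForm χ₁ θ x (χ₁ y - χ₁ x) = θ x u := by
    rw [← hu, chartForm_chartDeriv (IsManifold.maximalAtlas_subset_of_le hn' hχ₁) hx]
  have hlinear : chartForm χ₂ θ (f x) (fderiv ℝ (W.compRep f χ₁ χ₂) (0, χ₁ x)
      ((ε, χ₁ y) - (0, χ₁ x))) = c * θ x u + ε * θ (f x) (W.field (f x)) := by
    rw [Prod.mk_sub_mk, sub_zero, ← hu, W.fderiv_compRep hχ hχ₁ hχ₂ hf hx hfx hn,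
      chartForm_chartDeriv hχ₂' hfx, map_add, map_smul, hθ, smul_eq_mul]
  rw [hform, map_sub _ (W.compRep f χ₁ χ₂ (ε, χ₁ y) - _), hlinear]
  simp only [compRep, χ₁.left_inv hx, χ₁.left_inv hy, W.perturb_zero, sub_sub]

end ChartField

section Displacement

variable {E : Type*} [NormedAddCommGroup E] [NormedSpace ℝ E] {M : Type*} [EMetricSpace M]
  [ChartedSpace E M] {χ χ₁ χ₂ : OpenPartialHomeomorph M E} {Λ : Set M} {p : M}
  {θ : ∀ x : M, TangentSpace 𝓘(ℝ, E) x →L[ℝ] ℝ}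

theorem ContinuousForm.eventually_norm_chartForm_le (hθ : ContinuousForm Λ θ)
    (hχ : χ ∈ IsManifold.maximalAtlas 𝓘(ℝ, E) 1 M) (hp : p ∈ Λ) (hpχ : p ∈ χ.source) :
    ∃ U ∈ 𝓝[Λ] p, ∀ᶠ K : ℝ in atTop, ∀ x ∈ U, ‖chartForm χ θ x‖ ≤ K :=
  ⟨_, (hθ χ hχ p hp hpχ).norm.eventually (gt_mem_nhds (lt_add_one _)),
    (eventually_ge_atTop _).mono fun _ hK _ hx => (le_of_lt hx).trans hK⟩

section Step

variable {n : ℕ} (hχ : χ ∈ IsManifold.maximalAtlas 𝓘(ℝ, E) n M) (W : ChartField χ)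
  (hχ₁ : χ₁ ∈ IsManifold.maximalAtlas 𝓘(ℝ, E) n M)
  (hχ₂ : χ₂ ∈ IsManifold.maximalAtlas 𝓘(ℝ, E) n M) {f : M → M}
  (hf : ContMDiff 𝓘(ℝ, E) 𝓘(ℝ, E) n f) (hfΛ : MapsTo f Λ Λ) {a : M → ℝ}
  (hθf : ∀ x ∈ Λ, ∀ v, θ (f x) (mfderiv 𝓘(ℝ, E) 𝓘(ℝ, E) f x v) = a x * θ x v)
  (hθ : ContinuousForm Λ θ) (hn : 2 ≤ n) (hp : p ∈ Λ) (hpχ : p ∈ χ₁.source)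
  (hfp : f p ∈ χ₂.source)
include hχ hχ₁ hχ₂ hf hfΛ hθf hθ hn hp hpχ hfp

theorem ChartField.eventually_abs_chartForm_sub_linearization_le :
    ∃ U ∈ 𝓝[Λ] p, ∀ᶠ K : ℝ in atTop, ∀ x ∈ U, ∀ y ∈ χ₁.source, ∀ ε : ℝ,
      ‖(ε, χ₁ y - χ₁ x)‖ < K⁻¹ →
      |chartForm χ₂ θ (f x) (χ₂ (W.perturb ε (f y)) - χ₂ (f x)) -
        a x * chartForm χ₁ θ x (χ₁ y - χ₁ x) - ε * θ (f x) (W.field (f x))| ≤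
        K * ‖(ε, χ₁ y - χ₁ x)‖ ^ 2 := by
  have hn1 : 1 ≤ n := one_le_two.trans hn
  obtain ⟨U, hU, hform⟩ := hθ.eventually_norm_chartForm_le
    (IsManifold.maximalAtlas_subset_of_le (by exact_mod_cast hn1) hχ₂) (hfΛ hp) hfp
  obtain ⟨V, hV, htaylor⟩ := exists_eventually_taylor_of_contDiffAt
    ((W.contDiffAt_compRep hχ hχ₁ hχ₂ hf hpχ hfp).of_le (by exact_mod_cast hn))
  obtain ⟨K, hform, htaylor, hK⟩ := (hform.and (htaylor.and (eventually_ge_atTop 1))).exists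
  have hV' : (fun x => ((0 : ℝ), χ₁ x)) ⁻¹' V ∈ 𝓝 p :=
    (continuousAt_const.prodMk (χ₁.continuousAt hpχ)) hV
  have hU' : f ⁻¹' U ∈ 𝓝[Λ] p :=
    hf.continuous.continuousWithinAt.tendsto_nhdsWithin hfΛ hU
  refine ⟨Λ ∩ f ⁻¹' U ∩ ((fun x => ((0 : ℝ), χ₁ x)) ⁻¹' V ∩ (χ₁.source ∩ f ⁻¹' χ₂.source)),
    inter_mem (inter_mem self_mem_nhdsWithin hU') (mem_nhdsWithin_of_mem_nhds (inter_mem hV'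
      (inter_mem (χ₁.open_source.mem_nhds hpχ)
        (hf.continuous.continuousAt (χ₂.open_source.mem_nhds hfp))))), ?_⟩
  filter_upwards [eventually_ge_atTop (K ^ 2)] with L hL
  rintro x ⟨⟨hxΛ, hxU⟩, hxV, hx, hfx⟩ y hy ε hsmall
  have hKL : K ≤ L := (le_self_pow₀ hK two_ne_zero).trans hL
  have hmk : (ε, χ₁ y) - (0, χ₁ x) = (ε, χ₁ y - χ₁ x) := by rw [Prod.mk_sub_mk, sub_zero]
  rw [W.chartForm_sub_linearization hχ hχ₁ hχ₂ hf hx hfx hn1 (hθf x hxΛ) hy ε]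
  have hrem := htaylor _ hxV (ε, χ₁ y)
    (by rw [hmk]; exact hsmall.trans_le (by gcongr))
  rw [hmk] at hrem ⊢
  calc _ ≤ ‖chartForm χ₂ θ (f x)‖ * _ := (chartForm χ₂ θ (f x)).le_opNorm _
    _ ≤ K * (K * ‖(ε, χ₁ y - χ₁ x)‖ ^ 2) := by gcongr; exact hform _ hxU
    _ ≤ L * ‖(ε, χ₁ y - χ₁ x)‖ ^ 2 := by
        rw [← mul_assoc, ← sq]
        gcongr

variable [RiemannianBundle (fun x : M => TangentSpace 𝓘(ℝ, E) x)] [IsManifold 𝓘(ℝ, E) 1 M]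
  [IsContinuousRiemannianBundle E (fun x : M => TangentSpace 𝓘(ℝ, E) x)]
  [IsRiemannianManifold 𝓘(ℝ, E) M]

theorem ChartField.eventually_abs_chartForm_step_le :
    ∃ U ∈ 𝓝[Λ] p, ∀ᶠ K : ℝ in atTop, ∀ x ∈ U, ∀ y ε, ∀ δ < K⁻¹, |ε| ≤ δ →
      edist y x ≤ ENNReal.ofReal δ →
      |chartForm χ₂ θ (f x) (χ₂ (W.perturb ε (f y)) - χ₂ (f x)) -
        a x * chartForm χ₁ θ x (χ₁ y - χ₁ x) - ε * θ (f x) (W.field (f x))| ≤ K * δ ^ 2 := by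
  have hn1 : (1 : ℕ∞ω) ≤ n := by exact_mod_cast one_le_two.trans hn
  obtain ⟨U, hU, hsub⟩ := eventually_norm_chart_sub_le
    (IsManifold.maximalAtlas_subset_of_le hn1 hχ₁) hpχ
  obtain ⟨V, hV, hlin⟩ := W.eventually_abs_chartForm_sub_linearization_le hχ hχ₁ hχ₂ hf hfΛ hθf hθ
    hn hp hpχ hfp
  obtain ⟨K, hsub, hlin, hK⟩ := (hsub.and (hlin.and (eventually_ge_atTop 1))).exists
  refine ⟨U ∩ V, inter_mem (mem_nhdsWithin_of_mem_nhds hU) hV, ?_⟩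
  filter_upwards [eventually_ge_atTop (K ^ 3)] with L hL x hx y ε δ hδL hεδ hyδ
  have hδ0 : 0 ≤ δ := (abs_nonneg ε).trans hεδ
  have hδ : K * δ < K⁻¹ := calc
    K * δ < K * (K ^ 3)⁻¹ := by gcongr; exact hδL.trans_le (by gcongr)
    _ ≤ K * (K ^ 2)⁻¹ := by gcongr; norm_num
    _ = K⁻¹ := by field_simp
  have hclose : edist y x < ENNReal.ofReal K⁻¹ := hyδ.trans_lt
    ((ENNReal.ofReal_lt_ofReal_iff (by positivity)).2 ((le_mul_of_one_le_left hδ0 hK).trans_lt hδ))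
  obtain ⟨hy, hyx⟩ := hsub x hx.1 y hclose
  have hnorm : ‖(ε, χ₁ y - χ₁ x)‖ ≤ K * δ := by
    refine max_le (hεδ.trans (le_mul_of_one_le_left hδ0 hK)) (hyx.trans ?_)
    gcongr
    exact ENNReal.toReal_le_of_le_ofReal hδ0 hyδ
  calc _ ≤ K * ‖(ε, χ₁ y - χ₁ x)‖ ^ 2 := hlin x hx.2 y hy ε (hnorm.trans_lt hδ)
    _ ≤ K * (K * δ) ^ 2 := by gcongr
    _ = K ^ 3 * δ ^ 2 := by ring
    _ ≤ L * δ ^ 2 := by gcongr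

end Step

variable [RiemannianBundle (fun x : M => TangentSpace 𝓘(ℝ, E) x)] [IsManifold 𝓘(ℝ, E) 1 M]
  [IsContinuousRiemannianBundle E (fun x : M => TangentSpace 𝓘(ℝ, E) x)]
  [IsRiemannianManifold 𝓘(ℝ, E) M]

theorem ContinuousForm.eventually_abs_chartForm_sub_le (hθ : ContinuousForm Λ θ)
    (hχ : χ ∈ IsManifold.maximalAtlas 𝓘(ℝ, E) 1 M) (hp : p ∈ Λ) (hpχ : p ∈ χ.source) :
    ∃ U ∈ 𝓝[Λ] p, ∀ᶠ K : ℝ in atTop, ∀ x ∈ U, ∀ y, edist y x < ENNReal.ofReal K⁻¹ →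
      |chartForm χ θ x (χ y - χ x)| ≤ K := by
  obtain ⟨U, hU, hsub⟩ := eventually_norm_chart_sub_le hχ hpχ
  obtain ⟨V, hV, hform⟩ := hθ.eventually_norm_chartForm_le hχ hp hpχ
  refine ⟨U ∩ V, inter_mem (mem_nhdsWithin_of_mem_nhds hU) hV, ?_⟩
  filter_upwards [hsub, hform, eventually_gt_atTop 0] with K hsub hform hK x hx y hy
  have hclose : ‖χ y - χ x‖ ≤ 1 := calc
    _ ≤ K * (edist y x).toReal := (hsub x hx.1 y hy).2
    _ ≤ K * K⁻¹ := by
        gcongr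
        exact ENNReal.toReal_le_of_le_ofReal (by positivity) hy.le
    _ = 1 := mul_inv_cancel₀ hK.ne'
  calc |chartForm χ θ x (χ y - χ x)| ≤ ‖chartForm χ θ x‖ * ‖χ y - χ x‖ :=
        (chartForm χ θ x).le_opNorm _
    _ ≤ K * 1 := by gcongr; exact hform x hx.2
    _ = K := mul_one K

end Displacement

namespace CrGauge

section Displacement

variable {E : Type*} [NormedAddCommGroup E] [NormedSpace ℝ E] {M : Type*} [TopologicalSpace M]
  [ChartedSpace E M] {r : ℕ} (A : CrGauge E M r) {Λ : Set M}

theorem eventually_atTop_forall [T2Space M] (hΛ : IsCompact Λ) {f : M → M} (hf : Continuous f)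
    {P : ℝ → ℕ → ℕ → M → Prop} (h : ∀ i j, ∀ p ∈ Λ, p ∈ A.K i → f p ∈ A.K j →
      ∃ U ∈ 𝓝[Λ] p, ∀ᶠ K : ℝ in atTop, ∀ x ∈ U, P K i j x) :
    ∀ᶠ K in atTop, ∀ i j, ∀ x ∈ Λ, x ∈ A.K i → f x ∈ A.K j → P K i j x := by
  have hΛK (i : ℕ) : IsCompact (Λ ∩ A.K i) := hΛ.inter_right (A.isCompact_K i).isClosed
  refine eventually_forall_of_locallyFinite A.locallyFinite_K hΛ (fun i _ => ?_)
    fun i hi K j x hx hxi => (hi.le_bot ⟨hxi, hx⟩).elim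
  refine eventually_forall_of_locallyFinite (A.locallyFinite_K.preimage_continuous hf) (hΛK i)
    (fun j _ => ?_) fun j hj K x hx hxi hxj => (hj.le_bot ⟨hxj, hx, hxi⟩).elim
  have hcompact : IsCompact (Λ ∩ A.K i ∩ f ⁻¹' A.K j) :=
    (hΛK i).inter_right ((A.isCompact_K j).isClosed.preimage hf)
  filter_upwards [eventually_atTop_forall_of_isCompact hcompact fun p hp =>
    let ⟨U, hU, hK⟩ := h i j p hp.1.1 hp.1.2 hp.2
    ⟨U, nhdsWithin_mono p (fun _ hx => hx.1.1) hU, hK⟩] with K hK x hx hxi hxj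
  exact hK x ⟨⟨hx, hxi⟩, hxj⟩

theorem exists_mem_K (x : M) : ∃ i, x ∈ A.K i :=
  mem_iUnion.1 (A.iUnion_K.symm ▸ mem_univ x)

/-- The index of a set of the cover `A.K` that contains `x`. -/
def index (x : M) : ℕ :=
  (A.exists_mem_K x).choose

theorem mem_K_index (x : M) : x ∈ A.K (A.index x) :=
  (A.exists_mem_K x).choose_spec

/-- The value of the form `θ x` on the displacement from `x` to a nearby point `y`, read in the
chart of index `A.index x`; it depends on the chart to second order only. -/
def displacement (θ : ∀ x : M, TangentSpace 𝓘(ℝ, E) x →L[ℝ] ℝ) (x y : M) : ℝ :=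
  chartForm (A.χ (A.index x)) θ x (A.χ (A.index x) y - A.χ (A.index x) x)

end Displacement

variable {E : Type*} [NormedAddCommGroup E] [NormedSpace ℝ E] {M : Type*} [EMetricSpace M]
  [ChartedSpace E M] {r : ℕ} (A : CrGauge E M r) {Λ : Set M}
  {θ : ∀ x : M, TangentSpace 𝓘(ℝ, E) x →L[ℝ] ℝ}
  [RiemannianBundle (fun x : M => TangentSpace 𝓘(ℝ, E) x)] [IsManifold 𝓘(ℝ, E) 1 M]
  [IsContinuousRiemannianBundle E (fun x : M => TangentSpace 𝓘(ℝ, E) x)]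
  [IsRiemannianManifold 𝓘(ℝ, E) M]

theorem eventually_abs_displacement_le (hr : 1 ≤ r) (hΛ : IsCompact Λ)
    (hθ : ContinuousForm Λ θ) :
    ∀ᶠ K : ℝ in atTop, ∀ x ∈ Λ, ∀ y, edist y x < ENNReal.ofReal K⁻¹ →
      |A.displacement θ x y| ≤ K := by
  refine (A.eventually_atTop_forall hΛ continuous_id fun i j p hp hpi _ =>
    hθ.eventually_abs_chartForm_sub_le (IsManifold.maximalAtlas_subset_of_le
      (by exact_mod_cast hr) (A.χ_mem i)) hp (A.K_subset i hpi)).mono fun K hK x hx => ?_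
  exact hK _ (A.index x) x hx (A.mem_K_index x) (A.mem_K_index x)

theorem eventually_abs_displacement_step_le (hr : 2 ≤ r) (hΛ : IsCompact Λ)
    (hθ : ContinuousForm Λ θ) {i : ℕ} (W : ChartField (A.χ i)) {f : M → M}
    (hf : ContMDiff 𝓘(ℝ, E) 𝓘(ℝ, E) r f) (hfΛ : MapsTo f Λ Λ) {a : M → ℝ}
    (hθf : ∀ x ∈ Λ, ∀ v, θ (f x) (mfderiv 𝓘(ℝ, E) 𝓘(ℝ, E) f x v) = a x * θ x v) :
    ∀ᶠ K : ℝ in atTop, ∀ x ∈ Λ, ∀ y ε, ∀ δ < K⁻¹, |ε| ≤ δ → edist y x ≤ ENNReal.ofReal δ →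
      |A.displacement θ (f x) (W.perturb ε (f y)) - a x * A.displacement θ x y -
        ε * θ (f x) (W.field (f x))| ≤ K * δ ^ 2 := by
  refine (A.eventually_atTop_forall hΛ hf.continuous fun j k p hp hpj hpk =>
    W.eventually_abs_chartForm_step_le (A.χ_mem i) (A.χ_mem j) (A.χ_mem k) hf hfΛ hθf hθ hr hp
      (A.K_subset j hpj) (A.K_subset k hpk)).mono fun K hK x hx => ?_
  exact hK _ _ x hx (A.mem_K_index x) (A.mem_K_index (f x))

end CrGauge

section Exponents

open Asymptotics

theorem isLittleO_rpow_rpow {s t : ℝ} (h : s < t) :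
    (fun x : ℝ => x ^ t) =o[𝓝[>] 0] fun x => x ^ s := by
  have hzero : Tendsto (fun x : ℝ => x ^ (t - s)) (𝓝[>] 0) (𝓝 0) :=
    ((Real.continuous_rpow_const (sub_pos.2 h).le).tendsto' 0 0
      (Real.zero_rpow (sub_pos.2 h).ne')).mono_left nhdsWithin_le_nhds
  refine (isLittleO_iff_tendsto' ?_).2 (hzero.congr' ?_) <;>
    filter_upwards [self_mem_nhdsWithin] with x (hx : 0 < x)
  · exact fun h0 => absurd h0 (Real.rpow_pos_of_pos hx s).ne'
  · exact Real.rpow_sub hx t s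

theorem isLittleO_add_mul_rpow_sqrt {α : ℝ} (hα : 1 / 2 < α) (D : ℝ) :
    (fun ε : ℝ => ε + D * ε ^ α) =o[𝓝[>] 0] fun ε => √ε := by
  have hid : (fun ε : ℝ => ε) =o[𝓝[>] 0] fun ε => ε ^ (1 / 2 : ℝ) := by
    simpa only [Real.rpow_one] using isLittleO_rpow_rpow (show (1 / 2 : ℝ) < 1 by norm_num)
  simpa only [Real.sqrt_eq_rpow] using hid.add ((isLittleO_rpow_rpow hα).const_mul_left D)

end Exponents

section ApproximateSolutions

variable {X : Type*} {f : X → X} {Λ : Set X} {a b b' : X → ℝ}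

/-- The cohomological equation `u ∘ f = a * u + ε * b ∘ f` over `Λ` has, for small `ε > 0`, bounded
solutions up to errors that are small compared to `ε`. -/
def IsApproxSolvable (f : X → X) (Λ : Set X) (a b : X → ℝ) : Prop :=
  ∀ c > (0 : ℝ), ∀ᶠ ε : ℝ in 𝓝[>] 0, ∃ u : X → ℝ, (∃ B, ∀ x ∈ Λ, |u x| ≤ B) ∧
    ∀ x ∈ Λ, |u (f x) - a x * u x - ε * b (f x)| ≤ c * ε

namespace IsApproxSolvable

theorem zero : IsApproxSolvable f Λ a 0 := by
  intro c hc
  filter_upwards [self_mem_nhdsWithin] with ε (hε : 0 < ε)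
  exact ⟨0, ⟨0, by simp⟩, fun x _ => by simpa using by positivity⟩

theorem add (h : IsApproxSolvable f Λ a b) (h' : IsApproxSolvable f Λ a b') :
    IsApproxSolvable f Λ a (b + b') := by
  intro c hc
  filter_upwards [h (c / 2) (by positivity), h' (c / 2) (by positivity)]
    with ε ⟨u, ⟨B, hB⟩, hu⟩ ⟨u', ⟨B', hB'⟩, hu'⟩
  refine ⟨u + u', ⟨B + B', fun x hx => (abs_add_le _ _).trans (add_le_add (hB x hx) (hB' x hx))⟩,
    fun x hx => ?_⟩
  calc |(u + u') (f x) - a x * (u + u') x - ε * (b + b') (f x)|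
      = |(u (f x) - a x * u x - ε * b (f x)) + (u' (f x) - a x * u' x - ε * b' (f x))| := by
        simp only [Pi.add_apply]
        ring_nf
    _ ≤ c / 2 * ε + c / 2 * ε := (abs_add_le _ _).trans (add_le_add (hu x hx) (hu' x hx))
    _ = c * ε := by ring

theorem exists_supersolution (h : IsApproxSolvable f Λ a b) {β : ℝ} (hβ : 0 < β)
    (hf : MapsTo f Λ Λ) (hb : ∀ x ∈ Λ, β ≤ b x) :
    ∃ u : X → ℝ, (∃ B, ∀ x ∈ Λ, |u x| ≤ B) ∧ ∃ c > 0, ∀ x ∈ Λ, a x * u x + c ≤ u (f x) := by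
  obtain ⟨ε, ⟨u, hB, hu⟩, hε : 0 < ε⟩ :=
    ((h (β / 2) (by positivity)).and self_mem_nhdsWithin).exists
  refine ⟨u, hB, ε * (β / 2), by positivity, fun x hx => ?_⟩
  have hbx : ε * β ≤ ε * b (f x) := by gcongr; exact hb _ (hf hx)
  linarith [(abs_le.1 (hu x hx)).1]

end IsApproxSolvable

end ApproximateSolutions

section Stability

variable {E : Type*} [NormedAddCommGroup E] [NormedSpace ℝ E] {M : Type*} [EMetricSpace M]
  [ChartedSpace E M] {r : ℕ} {f : M ≃ₘ^r⟮𝓘(ℝ, E), 𝓘(ℝ, E)⟯ M} {Λ : Set M} {α : ℝ}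

/-- Hölder stability with respect to the `C^r` distance of `A` with the conjugacies replaced by
semiconjugacies `φ`, which need be neither injective nor continuous. Only the values of `φ` on `Λ`
matter. -/
def CrGauge.IsHolderSemistable (A : CrGauge E M r) (f : M ≃ₘ^r⟮𝓘(ℝ, E), 𝓘(ℝ, E)⟯ M) (Λ : Set M)
    (α : ℝ) : Prop :=
  ∃ ε > (0 : ℝ≥0), ∃ C : ℝ≥0, ∀ g : M ≃ₘ^r⟮𝓘(ℝ, E), 𝓘(ℝ, E)⟯ M, A.Adapted g →
    A.crDist f g < ε → ∃ φ : M → M, ∀ x ∈ Λ, (f x ∈ Λ → φ (f x) = g (φ x)) ∧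
      edist (φ x) x ≤ C * (A.crDist f g) ^ α

/-- Hölder stability under `C^r` perturbations with the conjugacies replaced by semiconjugacies,
for some choice of a `C^r` distance. -/
def IsHolderSemistable (f : M ≃ₘ^r⟮𝓘(ℝ, E), 𝓘(ℝ, E)⟯ M) (Λ : Set M) (α : ℝ) : Prop :=
  ∃ A : CrGauge E M r, A.Adapted f ∧ A.IsHolderSemistable f Λ α

theorem IsHolderStable.isHolderSemistable (h : IsHolderStable f Λ α) :
    IsHolderSemistable f Λ α := by
  obtain ⟨A, hA, ε, hε, C, -, h⟩ := h
  refine ⟨A, hA, ε, hε, C, fun g hgA hg => ?_⟩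
  obtain ⟨φ, -, hφ, hdist⟩ := h g hgA hg
  have hext (x : Λ) : Function.extend Subtype.val φ id (x : M) = φ x :=
    Subtype.val_injective.extend_apply φ id x
  refine ⟨Function.extend Subtype.val φ id, fun x hx => ⟨fun hfx => ?_, ?_⟩⟩
  · rw [hext ⟨x, hx⟩, ← hφ ⟨x, hx⟩ hfx, ← hext]
  · rw [hext ⟨x, hx⟩]
    exact hdist ⟨x, hx⟩

namespace CrGauge.IsHolderSemistable

variable [FiniteDimensional ℝ E] {A : CrGauge E M r} (hsemi : A.IsHolderSemistable f Λ α)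
  (hA : A.Adapted f) {j : ℕ} (W : ChartField (A.χ j))
include hsemi hA

theorem exists_eventually_semiconj_perturb (hr : r ≠ 0) (hα : 0 ≤ α) (hΛ : MapsTo f Λ Λ) :
    ∃ D ≥ 0, ∀ᶠ ε in 𝓝[>] (0 : ℝ), ∃ φ : M → M, ∀ x ∈ Λ,
      φ (f x) = W.perturb ε (f (φ x)) ∧ edist (φ x) x ≤ ENNReal.ofReal (D * ε ^ α) := by
  obtain ⟨ε₀, hε₀, C, hC⟩ := hsemi
  obtain ⟨D, hD⟩ := A.exists_eventually_crDist_perturb_comp_le hA W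
  have hsmall : ∀ᶠ ε in 𝓝 (0 : ℝ), ENNReal.ofReal (D * |ε|) < ε₀ := by
    have hcont : Continuous fun ε : ℝ => ENNReal.ofReal (D * |ε|) :=
      ENNReal.continuous_ofReal.comp (by fun_prop)
    exact hcont.continuousAt.eventually (gt_mem_nhds (by simpa using hε₀))
  refine ⟨C * |D| ^ α, by positivity, ?_⟩
  filter_upwards [self_mem_nhdsWithin, nhdsWithin_le_nhds (hD.and (hsmall.and
    ((A.eventually_adapted_perturb_comp hA W).and
      (W.eventually_exists_diffeomorph_perturb hr (A.χ_mem j)))))]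
    with ε (hε : 0 < ε) ⟨hDε, hεε₀, hAε, Ψ, hΨ⟩
  have hg : ⇑(f.trans Ψ) = W.perturb ε ∘ f := by rw [Diffeomorph.coe_trans, hΨ]
  rw [← hg] at hDε hAε
  obtain ⟨φ, hφ⟩ := hC (f.trans Ψ) hAε (hDε.trans_lt hεε₀)
  refine ⟨φ, fun x hx => ⟨?_, (hφ x hx).2.trans ?_⟩⟩
  · exact ((hφ x hx).1 (hΛ hx)).trans (congrFun hg _)
  · calc (C : ℝ≥0∞) * A.crDist f (f.trans Ψ) ^ α ≤ C * ENNReal.ofReal (|D| * ε) ^ α := by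
          gcongr
          refine hDε.trans (ENNReal.ofReal_le_ofReal ?_)
          rw [abs_of_pos hε]
          gcongr
          exact le_abs_self D
      _ = ENNReal.ofReal (C * |D| ^ α * ε ^ α) := by
          rw [ENNReal.ofReal_rpow_of_nonneg (by positivity) hα, mul_assoc,
            ENNReal.ofReal_mul C.coe_nonneg, ENNReal.ofReal_coe_nnreal,
            Real.mul_rpow (abs_nonneg D) hε.le]

theorem isApproxSolvable_field [RiemannianBundle (fun x : M => TangentSpace 𝓘(ℝ, E) x)]
    [IsManifold 𝓘(ℝ, E) 1 M]
    [IsContinuousRiemannianBundle E (fun x : M => TangentSpace 𝓘(ℝ, E) x)]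
    [IsRiemannianManifold 𝓘(ℝ, E) M] {θ : ∀ x : M, TangentSpace 𝓘(ℝ, E) x →L[ℝ] ℝ} {a : M → ℝ}
    (hr : 2 ≤ r) (hα : 1 / 2 < α) (hΛc : IsCompact Λ) (hΛ : MapsTo f Λ Λ)
    (hθ : ContinuousForm Λ θ)
    (hθf : ∀ x ∈ Λ, ∀ v, θ (f x) (mfderiv 𝓘(ℝ, E) 𝓘(ℝ, E) f x v) = a x * θ x v) :
    IsApproxSolvable f Λ a fun x => θ x (W.field x) := by
  intro c hc
  obtain ⟨D, hD0, hD⟩ :=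
    hsemi.exists_eventually_semiconj_perturb hA W (by lia) (by linarith) hΛ
  obtain ⟨K, hK0, hKbound, hKstep⟩ := ((eventually_gt_atTop (0 : ℝ)).and
    ((A.eventually_abs_displacement_le (by lia) hΛc hθ).and
      (A.eventually_abs_displacement_step_le hr hΛc hθ W f.contMDiff hΛ hθf))).exists
  have hδ := isLittleO_add_mul_rpow_sqrt hα D
  have hδ_lt : ∀ᶠ ε : ℝ in 𝓝[>] 0, ε + D * ε ^ α < K⁻¹ := by
    have hsqrt : Tendsto (fun ε : ℝ => √ε) (𝓝[>] 0) (𝓝 0) := by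
      simpa using (Real.continuous_sqrt.tendsto 0).mono_left nhdsWithin_le_nhds
    exact (hδ.trans_tendsto hsqrt).eventually (gt_mem_nhds (inv_pos.2 hK0))
  filter_upwards [self_mem_nhdsWithin, hD, hδ_lt, (hδ.pow two_pos).bound (div_pos hc hK0)]
    with ε (hε : 0 < ε) ⟨φ, hφ⟩ hεK hδ_sq
  have hεδ : |ε| ≤ ε + D * ε ^ α := by
    rw [abs_of_pos hε]
    exact le_add_of_nonneg_right (by positivity)
  have hdist (x : M) (hx : x ∈ Λ) : edist (φ x) x ≤ ENNReal.ofReal (ε + D * ε ^ α) :=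
    (hφ x hx).2.trans (ENNReal.ofReal_le_ofReal (le_add_of_nonneg_left hε.le))
  refine ⟨fun x => A.displacement θ x (φ x), ⟨K, fun x hx => hKbound x hx _
    ((hdist x hx).trans_lt ((ENNReal.ofReal_lt_ofReal_iff (inv_pos.2 hK0)).2 hεK))⟩,
    fun x hx => ?_⟩
  have hstep := hKstep x hx (φ x) ε _ hεK hεδ (hdist x hx)
  rw [← (hφ x hx).1] at hstep
  refine hstep.trans ?_
  rw [Real.sq_sqrt hε.le, Real.norm_of_nonneg (sq_nonneg _), Real.norm_of_nonneg hε.le] at hδ_sq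
  calc K * (ε + D * ε ^ α) ^ 2 ≤ K * (c / K * ε) := by gcongr
    _ = c * ε := by field_simp

end CrGauge.IsHolderSemistable

end Stability

section Existence

variable {E : Type*} [NormedAddCommGroup E] [NormedSpace ℝ E]

namespace ChartField

variable {M : Type*} [TopologicalSpace M] [ChartedSpace E M] {Λ : Set M}
  {θ : ∀ x : M, TangentSpace 𝓘(ℝ, E) x →L[ℝ] ℝ} {χ : OpenPartialHomeomorph M E} {p : M}

theorem apply_field (W : ChartField χ) (hχ : χ ∈ IsManifold.maximalAtlas 𝓘(ℝ, E) 1 M)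
    (hp : p ∈ χ.source) : θ p (W.field p) = chartForm χ θ p (W (χ p)) := by
  rw [← chartForm_chartDeriv hχ hp, W.chartDeriv_field hχ hp]

theorem eventually_lt_apply_field (W : ChartField χ)
    (hχ : χ ∈ IsManifold.maximalAtlas 𝓘(ℝ, E) 1 M) (hθ : ContinuousForm Λ θ) (hp : p ∈ Λ)
    (hpχ : p ∈ χ.source) {c : ℝ} (hc : c < θ p (W.field p)) :
    ∀ᶠ x in 𝓝[Λ] p, c < θ x (W.field x) := by
  rw [W.apply_field hχ hpχ] at hc
  have hW : ContinuousWithinAt (fun x => W (χ x)) Λ p :=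
    (W.contDiff.continuous.continuousAt.comp (χ.continuousAt hpχ)).continuousWithinAt
  filter_upwards [((hθ χ hχ p hp hpχ).clm_apply hW).eventually (lt_mem_nhds hc),
    nhdsWithin_le_nhds (χ.open_source.mem_nhds hpχ)] with x hx hxχ
  rwa [W.apply_field hχ hxχ]

theorem exists_apply_field_eq_one [FiniteDimensional ℝ E]
    (hχ : χ ∈ IsManifold.maximalAtlas 𝓘(ℝ, E) 1 M) (hθ : ContinuousForm Λ θ) (hp : p ∈ Λ)
    (hpχ : p ∈ χ.source) {v : TangentSpace 𝓘(ℝ, E) p} (hv : θ p v = 1) :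
    ∃ W : ChartField χ, (∀ x ∈ Λ, 0 ≤ θ x (W.field x)) ∧ θ p (W.field p) = 1 := by
  have hform : chartForm χ θ p (chartDeriv χ p v) = 1 := by rw [chartForm_chartDeriv hχ hpχ, hv]
  obtain ⟨O, hO, hpO, hOθ⟩ := mem_nhdsWithin.1 (((hθ χ hχ p hp hpχ).clm_apply
    continuousWithinAt_const).eventually (lt_mem_nhds (hform ▸ one_pos)))
  obtain ⟨ρ, hρ_supp, hρ_compact, hρ, hρ_range, hρp⟩ := exists_contDiff_tsupport_subset
    (n := (⊤ : ℕ∞)) ((χ.isOpen_inter_preimage_symm hO).mem_nhds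
      ⟨χ.map_source hpχ, by rwa [mem_preimage, χ.left_inv hpχ]⟩)
  let W : ChartField χ :=
    { toFun := fun w => ρ w • chartDeriv χ p v
      contDiff := hρ.smul contDiff_const
      hasCompactSupport := hρ_compact.smul_right
      tsupport_subset := (tsupport_smul_subset_left ρ _).trans (hρ_supp.trans inter_subset_left) }
  have hW (x : M) (hx : x ∈ χ.source) :
      θ x (W.field x) = ρ (χ x) * chartForm χ θ x (chartDeriv χ p v) :=
    (W.apply_field hχ hx).trans (map_smul (chartForm χ θ x) _ _)
  refine ⟨W, fun x hx => ?_, by rw [hW p hpχ, hρp, hform, one_mul]⟩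
  by_cases hxχ : x ∈ χ.source
  · rw [hW x hxχ]
    by_cases h0 : ρ (χ x) = 0
    · rw [h0, zero_mul]
    · have hxO := (hρ_supp (subset_tsupport _ h0)).2
      rw [mem_preimage, χ.left_inv hxχ] at hxO
      exact mul_nonneg (hρ_range ⟨_, rfl⟩).1 (le_of_lt (hOθ ⟨hxO, hx⟩))
  · rw [field, if_neg hxχ, map_zero]

end ChartField

variable [FiniteDimensional ℝ E] {M : Type*} [EMetricSpace M] [ChartedSpace E M]
  [IsManifold 𝓘(ℝ, E) 1 M] [RiemannianBundle (fun x : M => TangentSpace 𝓘(ℝ, E) x)]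
  [IsContinuousRiemannianBundle E (fun x : M => TangentSpace 𝓘(ℝ, E) x)]
  [IsRiemannianManifold 𝓘(ℝ, E) M] {r : ℕ} {f : M ≃ₘ^r⟮𝓘(ℝ, E), 𝓘(ℝ, E)⟯ M} {Λ : Set M}
  {α : ℝ} {X : ∀ x : M, TangentSpace 𝓘(ℝ, E) x}
  {θ : ∀ x : M, TangentSpace 𝓘(ℝ, E) x →L[ℝ] ℝ} {a : M → ℝ}

theorem IsHolderSemistable.exists_isApproxSolvable (hsemi : IsHolderSemistable f Λ α) (hr : 2 ≤ r)
    (hα : 1 / 2 < α) (hΛc : IsCompact Λ) (hΛ : MapsTo f Λ Λ) (hθ : ContinuousForm Λ θ)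
    (hθX : ∀ x ∈ Λ, θ x (X x) = 1)
    (hθf : ∀ x ∈ Λ, ∀ v, θ (f x) (mfderiv 𝓘(ℝ, E) 𝓘(ℝ, E) f x v) = a x * θ x v) :
    ∃ b : M → ℝ, (∀ x ∈ Λ, 1 / 2 ≤ b x) ∧ IsApproxSolvable f Λ a b := by
  obtain ⟨A, hA, hsemi⟩ := hsemi
  have hlocal (p : M) (hp : p ∈ Λ) : ∃ b : M → ℝ, (∀ x ∈ Λ, 0 ≤ b x) ∧
      (∀ᶠ x in 𝓝[Λ] p, 1 / 2 < b x) ∧ IsApproxSolvable f Λ a b := by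
    obtain ⟨j, hj⟩ := A.exists_mem_K p
    have hpχ := A.K_subset j hj
    have hχ : A.χ j ∈ IsManifold.maximalAtlas 𝓘(ℝ, E) 1 M :=
      IsManifold.maximalAtlas_subset_of_le (by exact_mod_cast one_le_two.trans hr) (A.χ_mem j)
    obtain ⟨W, hW0, hWp⟩ := ChartField.exists_apply_field_eq_one hχ hθ hp hpχ (hθX p hp)
    exact ⟨_, hW0, W.eventually_lt_apply_field hχ hθ hp hpχ (by rw [hWp]; norm_num),
      hsemi.isApproxSolvable_field hA W hr hα hΛc hΛ hθ hθf⟩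
  obtain ⟨b, -, hb, hsol⟩ := hΛc.induction_on (p := fun s => ∃ b : M → ℝ, (∀ x ∈ Λ, 0 ≤ b x) ∧
      (∀ x ∈ s ∩ Λ, 1 / 2 ≤ b x) ∧ IsApproxSolvable f Λ a b)
    ⟨0, by simp, by simp, .zero⟩
    (fun s t hst ⟨b, hb0, hb, hsol⟩ => ⟨b, hb0, fun x hx => hb x ⟨hst hx.1, hx.2⟩, hsol⟩)
    (fun s t ⟨b, hb0, hb, hsol⟩ ⟨b', hb0', hb', hsol'⟩ => ⟨b + b',
      fun x hx => add_nonneg (hb0 x hx) (hb0' x hx), fun x ⟨hxst, hx⟩ => hxst.elim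
        (fun hxs => (hb x ⟨hxs, hx⟩).trans (le_add_of_nonneg_right (hb0' x hx)))
        (fun hxt => (hb' x ⟨hxt, hx⟩).trans (le_add_of_nonneg_left (hb0 x hx))),
      hsol.add hsol'⟩)
    (fun p hp =>
      let ⟨b, hb0, hb, hsol⟩ := hlocal p hp
      ⟨_, hb, b, hb0, fun _ hx => le_of_lt hx.1, hsol⟩)
  exact ⟨b, fun x hx => hb x ⟨hx, hx⟩, hsol⟩

end Existence

section Density

variable {X Y : Type*} [TopologicalSpace X] [TopologicalSpace Y] {f : X → X} {Λ : Set X} {z : X}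

theorem subset_closure_iterate_tail (hf : Continuous f) (hΛ : f '' Λ = Λ)
    (hz : Λ ⊆ closure (range fun n : ℕ => f^[n] z)) (N : ℕ) :
    Λ ⊆ closure ((fun n : ℕ => f^[n] z) '' Ici N) := by
  induction N with
  | zero => simpa using hz
  | succ N ih =>
    calc Λ = f '' Λ := hΛ.symm
      _ ⊆ f '' closure ((fun n : ℕ => f^[n] z) '' Ici N) := image_mono ih
      _ ⊆ closure (f '' ((fun n : ℕ => f^[n] z) '' Ici N)) := image_closure_subset_closure_image hf
      _ ⊆ closure ((fun n : ℕ => f^[n] z) '' Ici (N + 1)) := by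
        refine closure_mono ?_
        rintro _ ⟨_, ⟨n, hn, rfl⟩, rfl⟩
        exact ⟨n + 1, Nat.succ_le_succ hn, Function.iterate_succ_apply' f n z⟩

variable (hf : Continuous f) (hΛ : f '' Λ = Λ) (hzΛ : z ∈ Λ)
  (hz : Λ ⊆ closure (range fun n : ℕ => f^[n] z))
include hf hΛ hzΛ hz

theorem forall_mem_of_iterate_tail {g : X → Y} (hg : ContinuousOn g Λ) {S : Set Y}
    (hS : IsClosed S) {N : ℕ} (h : ∀ n ≥ N, g (f^[n] z) ∈ S) {x : X} (hx : x ∈ Λ) : g x ∈ S := by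
  have horbit : (fun n : ℕ => f^[n] z) '' Ici N ⊆ Λ :=
    image_subset_iff.2 fun n _ => (mapsTo_iff_image_subset.2 hΛ.subset).iterate n hzΛ
  refine hS.closure_subset_iff.2 ?_ (((hg x hx).mono horbit).mem_closure_image
    (subset_closure_iterate_tail hf hΛ hz N hx))
  rintro _ ⟨_, ⟨n, hn, rfl⟩, rfl⟩
  exact h n hn

theorem prod_iterate_decay_or_growth_of_supersolution (hΛc : IsCompact Λ) {a u : X → ℝ}
    (hac : ContinuousOn a Λ) (ha : ∀ x ∈ Λ, 0 < a x) {K : ℝ} (hK : ∀ x ∈ Λ, |u x| ≤ K) {c : ℝ}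
    (hc : 0 < c) (hu : ∀ x ∈ Λ, a x * u x + c ≤ u (f x)) :
    ∃ C > 0, ∃ μ : ℝ, 0 < μ ∧ μ < 1 ∧
      ((∀ x ∈ Λ, ∀ n, ∏ i ∈ Finset.range n, a (f^[i] x) ≤ C * μ ^ n) ∨
        ∀ x ∈ Λ, ∀ n, 1 ≤ C * μ ^ n * ∏ i ∈ Finset.range n, a (f^[i] x)) := by
  have hmaps : MapsTo f Λ Λ := mapsTo_iff_image_subset.2 hΛ.subset
  have horbit (n : ℕ) : f^[n] z ∈ Λ := hmaps.iterate n hzΛ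
  obtain ⟨B, hB⟩ := (hΛc.image_of_continuousOn hac).bddAbove
  obtain ⟨C, hC, μ, hμ, hμ1, hcase⟩ := prod_decay_or_growth_of_supersolution
    (a := fun n => a (f^[n] z)) (u := fun n => u (f^[n] z)) hc (fun n => ha _ (horbit n))
    (fun n => hB (mem_image_of_mem a (horbit n))) (fun n => hK _ (horbit n)) fun n => by
      simpa only [Function.iterate_succ_apply'] using hu _ (horbit n)
  have hprod (k : ℕ) : ContinuousOn (fun x => ∏ i ∈ Finset.range k, a (f^[i] x)) Λ :=
    continuousOn_finsetProd _ fun i _ =>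
      hac.comp (hf.iterate i).continuousOn (hmaps.iterate i)
  have hshift (n k : ℕ) : ∏ i ∈ Finset.range k, a (f^[n + i] z) =
      ∏ i ∈ Finset.range k, a (f^[i] (f^[n] z)) :=
    Finset.prod_congr rfl fun i _ => by rw [add_comm, Function.iterate_add_apply]
  simp only [hshift] at hcase
  refine ⟨C, hC, μ, hμ, hμ1, ?_⟩
  rcases hcase with ⟨N, hdecay⟩ | hgrowth
  · exact .inl fun x hx k => forall_mem_of_iterate_tail hf hΛ hzΛ hz (hprod k) isClosed_Iic
      (fun n hn => hdecay n hn k) hx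
  · exact .inr fun x hx k => forall_mem_of_iterate_tail hf hΛ hzΛ hz
      (g := fun x => C * μ ^ k * ∏ i ∈ Finset.range k, a (f^[i] x))
      (continuousOn_const.mul (hprod k)) isClosed_Ici (N := 0) (fun n _ => hgrowth n k) hx

end Density

section Iterates

variable {E : Type*} [NormedAddCommGroup E] [NormedSpace ℝ E]
  {M : Type*} [TopologicalSpace M] [ChartedSpace E M] {r : ℕ}
  {f : M ≃ₘ^r⟮𝓘(ℝ, E), 𝓘(ℝ, E)⟯ M} {Λ : Set M} {X : ∀ x : M, TangentSpace 𝓘(ℝ, E) x} {a : M → ℝ}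

theorem mfderiv_iterate_field (hr : r ≠ 0) (hΛ : MapsTo f Λ Λ)
    (ha : ∀ x ∈ Λ, mfderiv 𝓘(ℝ, E) 𝓘(ℝ, E) f x (X x) = a x • X (f x)) {x : M} (hx : x ∈ Λ)
    (n : ℕ) : mfderiv 𝓘(ℝ, E) 𝓘(ℝ, E) (f^[n]) x (X x) =
      (∏ i ∈ Finset.range n, a (f^[i] x)) • X (f^[n] x) := by
  have hr' : (r : ℕ∞ω) ≠ 0 := by exact_mod_cast hr
  induction n with
  | zero =>
    rw [Finset.range_zero, Finset.prod_empty, one_smul, Function.iterate_zero, mfderiv_id]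
    rfl
  | succ n ih =>
    have hcomp : mfderiv 𝓘(ℝ, E) 𝓘(ℝ, E) (f ∘ f^[n]) x (X x) =
        mfderiv 𝓘(ℝ, E) 𝓘(ℝ, E) f (f^[n] x) (mfderiv 𝓘(ℝ, E) 𝓘(ℝ, E) (f^[n]) x (X x)) :=
      mfderiv_comp_apply x (f.contMDiff.mdifferentiableAt hr')
        ((f.contMDiff.iterate n).mdifferentiableAt hr') _
    rw [ih, map_smul, ha _ (hΛ.iterate n hx), smul_smul] at hcomp
    rw [Finset.prod_range_succ, Function.iterate_succ', Function.comp_apply]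
    exact hcomp

theorem prod_smul_mfderiv_symm_iterate_field (hr : r ≠ 0) (hΛ : MapsTo f Λ Λ)
    (ha : ∀ x ∈ Λ, mfderiv 𝓘(ℝ, E) 𝓘(ℝ, E) f x (X x) = a x • X (f x)) {x : M} (hx : x ∈ Λ)
    (n : ℕ) : (∏ i ∈ Finset.range n, a (f^[i] x)) •
      mfderiv 𝓘(ℝ, E) 𝓘(ℝ, E) (f.symm^[n]) (f^[n] x) (X (f^[n] x)) =
        X (f.symm^[n] (f^[n] x)) := by
  have hr' : (r : ℕ∞ω) ≠ 0 := by exact_mod_cast hr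
  have hinv : f.symm^[n] ∘ f^[n] = id :=
    funext (Function.LeftInverse.iterate f.symm_apply_apply n)
  have hcomp : mfderiv 𝓘(ℝ, E) 𝓘(ℝ, E) (f.symm^[n] ∘ f^[n]) x (X x) =
      mfderiv 𝓘(ℝ, E) 𝓘(ℝ, E) (f.symm^[n]) (f^[n] x)
        (mfderiv 𝓘(ℝ, E) 𝓘(ℝ, E) (f^[n]) x (X x)) :=
    mfderiv_comp_apply x ((f.symm.contMDiff.iterate n).mdifferentiableAt hr')
      ((f.contMDiff.iterate n).mdifferentiableAt hr') _
  have hid : (mfderiv 𝓘(ℝ, E) 𝓘(ℝ, E) (f.symm^[n] ∘ f^[n]) x (X x) : E) = X x := by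
    rw [hinv, mfderiv_id]
    rfl
  have hX : ∀ y, y = x → (X y : E) = X x := by
    rintro y rfl
    rfl
  rw [mfderiv_iterate_field hr hΛ ha hx n, map_smul] at hcomp
  exact hcomp.symm.trans (hid.trans (hX _ (congrFun hinv x)).symm)

end Iterates

section Contraction

variable {E : Type*} [NormedAddCommGroup E] [NormedSpace ℝ E]
  {M : Type*} [TopologicalSpace M] [ChartedSpace E M]
  [RiemannianBundle (fun x : M => TangentSpace 𝓘(ℝ, E) x)] {r : ℕ}
  {f : M ≃ₘ^r⟮𝓘(ℝ, E), 𝓘(ℝ, E)⟯ M} {Λ : Set M}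
  {F G H : ∀ x : M, Submodule ℝ (TangentSpace 𝓘(ℝ, E) x)} {X : ∀ x : M, TangentSpace 𝓘(ℝ, E) x}
  {a : M → ℝ} {C μ : ℝ}

theorem IsContracted.sup {K : ℝ} (hF : IsContracted f Λ F) (hG : IsContracted f Λ G)
    (hFG : ∀ x ∈ Λ, ∀ v ∈ F x, ∀ w ∈ G x, ‖w‖ ≤ K * ‖v + w‖) :
    IsContracted f Λ fun x => F x ⊔ G x := by
  obtain ⟨C, hC, lam, hlam, hlam1, hF⟩ := hF
  obtain ⟨D, hD, μ, hμ, hμ1, hG⟩ := hG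
  refine ⟨C * (1 + |K|) + D * |K|, by positivity, max lam μ, lt_max_of_lt_left hlam,
    max_lt hlam1 hμ1, fun x hx y hy n => ?_⟩
  obtain ⟨v, hv, w, hw, rfl⟩ := Submodule.mem_sup.1 hy
  have hw_le : ‖w‖ ≤ |K| * ‖v + w‖ :=
    (hFG x hx v hv w hw).trans (mul_le_mul_of_nonneg_right (le_abs_self K) (norm_nonneg _))
  have hv_le : ‖v‖ ≤ (1 + |K|) * ‖v + w‖ := by
    have htri : ‖v‖ ≤ ‖v + w‖ + ‖w‖ := by simpa using norm_sub_le (v + w) w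
    linarith
  rw [map_add]
  calc _ ≤ C * lam ^ n * ‖v‖ + D * μ ^ n * ‖w‖ :=
        (norm_add_le _ _).trans (add_le_add (hF x hx v hv n) (hG x hx w hw n))
    _ ≤ C * max lam μ ^ n * ((1 + |K|) * ‖v + w‖) + D * max lam μ ^ n * (|K| * ‖v + w‖) := by
        gcongr
        exacts [le_max_left _ _, le_max_right _ _]
    _ = _ := by ring

theorem isContracted_span (hC : 0 < C) (hμ : 0 < μ) (hμ1 : μ < 1) (h : ∀ x ∈ Λ, ∀ n : ℕ,
      ‖mfderiv 𝓘(ℝ, E) 𝓘(ℝ, E) (f^[n]) x (X x)‖ ≤ C * μ ^ n * ‖X x‖) :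
    IsContracted f Λ fun x => Submodule.span ℝ {X x} := by
  refine ⟨C, hC, μ, hμ, hμ1, fun x hx v hv n => ?_⟩
  obtain ⟨t, rfl⟩ := Submodule.mem_span_singleton.1 hv
  rw [map_smul, norm_smul, norm_smul, mul_left_comm]
  gcongr
  exact h x hx n

theorem IsContracted.sup_span {K : ℝ} {θ : ∀ x : M, TangentSpace 𝓘(ℝ, E) x →L[ℝ] ℝ}
    (hF : IsContracted f Λ F) (hspan : IsContracted f Λ fun x => Submodule.span ℝ {X x})
    (hX : ∀ x ∈ Λ, ‖X x‖ = 1) (hθ : IsCoordinateAlong Λ X H θ) (hFH : ∀ x ∈ Λ, F x ≤ H x)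
    (hK : ∀ x ∈ Λ, ∀ v : TangentSpace 𝓘(ℝ, E) x, |θ x v| ≤ K * ‖v‖) :
    IsContracted f Λ fun x => F x ⊔ Submodule.span ℝ {X x} := by
  refine hF.sup hspan (K := K) fun x hx v hv w hw => ?_
  obtain ⟨t, rfl⟩ := Submodule.mem_span_singleton.1 hw
  have hθt : θ x (v + t • X x) = t := by
    rw [map_add, map_smul, hθ.apply_eq_zero x hx v (hFH x hx hv), hθ.apply_field x hx, zero_add,
      smul_eq_mul, mul_one]
  calc ‖t • X x‖ = |θ x (v + t • X x)| := by
        rw [norm_smul, hX x hx, mul_one, hθt, Real.norm_eq_abs]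
    _ ≤ K * ‖v + t • X x‖ := hK x hx _

variable (hr : r ≠ 0) (hX : ∀ x ∈ Λ, ‖X x‖ = 1) (ha : ∀ x ∈ Λ, 0 < a x)
  (hXa : ∀ x ∈ Λ, mfderiv 𝓘(ℝ, E) 𝓘(ℝ, E) f x (X x) = a x • X (f x))
  (hC : 0 < C) (hμ : 0 < μ) (hμ1 : μ < 1)
include hr hX ha hXa hC hμ hμ1

theorem isContracted_span_of_prod_le (hΛ : MapsTo f Λ Λ)
    (h : ∀ x ∈ Λ, ∀ n, ∏ i ∈ Finset.range n, a (f^[i] x) ≤ C * μ ^ n) :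
    IsContracted f Λ fun x => Submodule.span ℝ {X x} :=
  isContracted_span hC hμ hμ1 fun x hx n => by
    rw [mfderiv_iterate_field hr hΛ hXa hx, norm_smul, hX x hx, hX _ (hΛ.iterate n hx),
      Real.norm_of_nonneg (Finset.prod_nonneg fun i _ => (ha _ (hΛ.iterate i hx)).le), mul_one,
      mul_one]
    exact h x hx n

theorem isContracted_symm_span_of_one_le_prod (hΛ : f '' Λ = Λ)
    (h : ∀ x ∈ Λ, ∀ n, 1 ≤ C * μ ^ n * ∏ i ∈ Finset.range n, a (f^[i] x)) :
    IsContracted f.symm Λ fun x => Submodule.span ℝ {X x} := by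
  refine isContracted_span hC hμ hμ1 fun x hx n => ?_
  have hmaps : MapsTo f Λ Λ := mapsTo_iff_image_subset.2 hΛ.subset
  have himage : f^[n] '' Λ = Λ := image_iterate_eq ▸ Function.iterate_fixed hΛ n
  obtain ⟨y, hy, rfl⟩ := himage.ge hx
  have hsymm : f.symm^[n] (f^[n] y) = y := Function.LeftInverse.iterate f.symm_apply_apply n y
  have hprod : 0 < ∏ i ∈ Finset.range n, a (f^[i] y) :=
    Finset.prod_pos fun i _ => ha _ (hmaps.iterate i hy)
  have hnorm := congrArg norm (prod_smul_mfderiv_symm_iterate_field hr hmaps hXa hy n)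
  rw [norm_smul, Real.norm_of_nonneg hprod.le, hX _ (hsymm.symm ▸ hy)] at hnorm
  rw [hX _ hx, mul_one, eq_div_of_mul_eq hprod.ne' ((mul_comm _ _).trans hnorm),
    div_le_iff₀ hprod]
  exact h y hy n

end Contraction

section CentreSplitting

variable {E : Type*} [NormedAddCommGroup E] [NormedSpace ℝ E]
  {M : Type*} [TopologicalSpace M] [ChartedSpace E M] [IsManifold 𝓘(ℝ, E) 1 M]
  [RiemannianBundle (fun x : M => TangentSpace 𝓘(ℝ, E) x)] {r : ℕ}
  {f : M ≃ₘ^r⟮𝓘(ℝ, E), 𝓘(ℝ, E)⟯ M} {Λ : Set M}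
  {Es Ec Eu : ∀ x : M, Submodule ℝ (TangentSpace 𝓘(ℝ, E) x)}
  {X : ∀ x : M, TangentSpace 𝓘(ℝ, E) x} {a : M → ℝ}

/-- A splitting `T_Λ M = Es ⊕ ℝ X ⊕ Eu` with `Es` contracted, `Eu` expanded and a centre line
spanned by a continuous unit field `X` which `Df` multiplies by the positive function `a`. It is
what partial hyperbolicity with an oriented one-dimensional centre gives without domination. -/
structure IsCentreSplitting (f : M ≃ₘ^r⟮𝓘(ℝ, E), 𝓘(ℝ, E)⟯ M) (Λ : Set M)
    (Es Eu : ∀ x : M, Submodule ℝ (TangentSpace 𝓘(ℝ, E) x))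
    (X : ∀ x : M, TangentSpace 𝓘(ℝ, E) x) (a : M → ℝ) : Prop where
  subbundle_s : IsSubbundle Λ Es
  subbundle_u : IsSubbundle Λ Eu
  invariant_s : IsDInvariant f Λ Es
  invariant_u : IsDInvariant f Λ Eu
  contracted_s : IsContracted f Λ Es
  contracted_u : IsContracted f.symm Λ Eu
  continuousField : ContinuousField Λ X
  norm_field : ∀ x ∈ Λ, ‖X x‖ = 1
  continuousOn_rate : ContinuousOn a Λ
  rate_pos : ∀ x ∈ Λ, 0 < a x
  mfderiv_field : ∀ x ∈ Λ, mfderiv 𝓘(ℝ, E) 𝓘(ℝ, E) f x (X x) = a x • X (f x)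
  disjoint_s_span : ∀ x ∈ Λ, Disjoint (Es x) (Submodule.span ℝ {X x})
  isCompl_s_span_u : ∀ x ∈ Λ, IsCompl (Es x ⊔ Submodule.span ℝ {X x}) (Eu x)

theorem IsPartiallyHyperbolic.exists_isCentreSplitting (hph : IsPartiallyHyperbolic f Λ Es Ec Eu)
    (hdim : ∀ x ∈ Λ, Module.finrank ℝ (Ec x) = 1) (horient : IsOrientation Λ Ec X)
    (hpres : PreservesOrientation f Λ X) : ∃ a, IsCentreSplitting f Λ Es Eu X a := by
  obtain ⟨a, hac, ha⟩ := hpres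
  have hspan (x : M) (hx : x ∈ Λ) : Submodule.span ℝ {X x} = Ec x := by
    obtain ⟨hXc, hX⟩ := horient.2 x hx
    have hX0 : X x ≠ 0 := norm_ne_zero_iff.1 (hX ▸ one_ne_zero)
    have := Module.finite_of_finrank_eq_succ (hdim x hx)
    exact Submodule.eq_of_le_of_finrank_eq ((Submodule.span_singleton_le_iff_mem _ _).2 hXc)
      ((finrank_span_singleton hX0).trans (hdim x hx).symm)
  exact ⟨a,
    { subbundle_s := hph.subbundle_s
      subbundle_u := hph.subbundle_u
      invariant_s := hph.invariant_s
      invariant_u := hph.invariant_u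
      contracted_s := hph.contracted_s
      contracted_u := hph.contracted_u
      continuousField := horient.1
      norm_field := fun x hx => (horient.2 x hx).2
      continuousOn_rate := hac
      rate_pos := fun x hx => (ha x hx).1
      mfderiv_field := fun x hx => (ha x hx).2
      disjoint_s_span := fun x hx => hspan x hx ▸ hph.disjoint_s_c x hx
      isCompl_s_span_u := fun x hx => hspan x hx ▸ hph.isCompl_sc_u x hx }⟩

namespace IsCentreSplitting

variable (h : IsCentreSplitting f Λ Es Eu X a)
include h

theorem field_ne_zero : ∀ x ∈ Λ, X x ≠ 0 := fun x hx =>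
  norm_ne_zero_iff.1 (h.norm_field x hx ▸ one_ne_zero)

theorem isCompl_s_u_span : ∀ x ∈ Λ, IsCompl (Es x) (Eu x ⊔ Submodule.span ℝ {X x}) :=
  fun x hx => sup_comm (Submodule.span ℝ {X x}) (Eu x) ▸
    (h.disjoint_s_span x hx).isCompl_sup_right_of_isCompl_sup_left (h.isCompl_s_span_u x hx)

theorem isCompl_span_s_u : ∀ x ∈ Λ, IsCompl (Submodule.span ℝ {X x}) (Es x ⊔ Eu x) :=
  fun x hx => (h.disjoint_s_span x hx).symm.isCompl_sup_right_of_isCompl_sup_left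
    (sup_comm (Es x) _ ▸ h.isCompl_s_span_u x hx)

theorem isDInvariant_span : IsDInvariant f Λ fun x => Submodule.span ℝ {X x} :=
  HolderStability.isDInvariant_span (fun x hx => (h.rate_pos x hx).ne') h.mfderiv_field

theorem isSubbundle_span : IsSubbundle Λ fun x => Submodule.span ℝ {X x} :=
  HolderStability.isSubbundle_span h.continuousField h.field_ne_zero

theorem exists_continuousForm_isCoordinateAlong [FiniteDimensional ℝ E] :
    ∃ θ, ContinuousForm Λ θ ∧ IsCoordinateAlong Λ X (fun x => Es x ⊔ Eu x) θ := by
  obtain ⟨θ, hθ⟩ := exists_isCoordinateAlong (X := X) (H := fun x => Es x ⊔ Eu x)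
    fun x hx => (Submodule.disjoint_span_singleton' (h.field_ne_zero x hx)).1
      (h.isCompl_span_s_u x hx).disjoint.symm
  refine ⟨θ, hθ.continuousForm (h.subbundle_s.sup h.subbundle_u fun x hx => ?_) h.continuousField
    fun x hx => (h.isCompl_span_s_u x hx).sup_eq_top, hθ⟩
  exact (h.isCompl_s_span_u x hx).disjoint.mono_left le_sup_left

variable {θ : ∀ x : M, TangentSpace 𝓘(ℝ, E) x →L[ℝ] ℝ}
  (hθ : IsCoordinateAlong Λ X (fun x => Es x ⊔ Eu x) θ)

include hθ in
theorem apply_mfderiv (hΛ : MapsTo f Λ Λ) : ∀ x ∈ Λ, ∀ v,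
    θ (f x) (mfderiv 𝓘(ℝ, E) 𝓘(ℝ, E) f x v) = a x * θ x v := fun _ hx v =>
  hθ.apply_mfderiv (h.invariant_s.sup h.invariant_u)
    (fun y hy => (h.isCompl_span_s_u y hy).sup_eq_top) hΛ h.mfderiv_field hx v

theorem isHyperbolic_of_isContracted {K : ℝ}
    (hcase : IsContracted f Λ (fun x => Submodule.span ℝ {X x}) ∨
      IsContracted f.symm Λ fun x => Submodule.span ℝ {X x})
    (hθ : IsCoordinateAlong Λ X (fun x => Es x ⊔ Eu x) θ)
    (hK : ∀ x ∈ Λ, ∀ v : TangentSpace 𝓘(ℝ, E) x, |θ x v| ≤ K * ‖v‖) : IsHyperbolic f Λ := by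
  rcases hcase with hcontr | hexp
  · exact ⟨fun x => Es x ⊔ Submodule.span ℝ {X x}, Eu,
      h.subbundle_s.sup h.isSubbundle_span h.disjoint_s_span, h.subbundle_u,
      h.invariant_s.sup h.isDInvariant_span, h.invariant_u, h.isCompl_s_span_u,
      h.contracted_s.sup_span hcontr h.norm_field hθ (fun _ _ => le_sup_left) hK, h.contracted_u⟩
  · exact ⟨Es, fun x => Eu x ⊔ Submodule.span ℝ {X x}, h.subbundle_s,
      h.subbundle_u.sup h.isSubbundle_span
        fun x hx => (h.isCompl_s_span_u x hx).disjoint.symm.mono_right le_sup_right,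
      h.invariant_s, h.invariant_u.sup h.isDInvariant_span, h.isCompl_s_u_span, h.contracted_s,
      h.contracted_u.sup_span hexp h.norm_field hθ (fun _ _ => le_sup_right) hK⟩

end IsCentreSplitting

end CentreSplitting

end HolderStability

end

theorem corollary1p3_general
    {E : Type*} [NormedAddCommGroup E] [NormedSpace ℝ E] [FiniteDimensional ℝ E]
    {M : Type*} [EMetricSpace M] [ChartedSpace E M] [IsManifold 𝓘(ℝ, E) 1 M]
    [RiemannianBundle (fun x : M => TangentSpace 𝓘(ℝ, E) x)]
    [IsContinuousRiemannianBundle E (fun x : M => TangentSpace 𝓘(ℝ, E) x)]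
    [IsRiemannianManifold 𝓘(ℝ, E) M]
    {r : ℕ} (hr : 2 ≤ r) {f : M ≃ₘ^r⟮𝓘(ℝ, E), 𝓘(ℝ, E)⟯ M}
    {Λ : Set M} (hcompact : IsCompact Λ) (hinv : f '' Λ = Λ)
    (htrans : HolderStability.IsTransitive f Λ)
    {Es Eu : ∀ x : M, Submodule ℝ (TangentSpace 𝓘(ℝ, E) x)}
    {X : ∀ x : M, TangentSpace 𝓘(ℝ, E) x} {a : M → ℝ}
    (hsplit : HolderStability.IsCentreSplitting f Λ Es Eu X a)
    {α : ℝ} (hα : 1 / 2 < α) (hstable : HolderStability.IsHolderSemistable f Λ α) :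
    HolderStability.IsHyperbolic f Λ := by
  obtain ⟨z, hz, hdense⟩ := htrans
  have hΛ : MapsTo f Λ Λ := mapsTo_iff_image_subset.2 hinv.subset
  obtain ⟨θ, hθc, hθ⟩ := hsplit.exists_continuousForm_isCoordinateAlong
  obtain ⟨K, hK⟩ := hθc.exists_bound hcompact
  obtain ⟨b, hb, hsol⟩ := hstable.exists_isApproxSolvable hr hα hcompact hΛ hθc hθ.apply_field
    (hsplit.apply_mfderiv hθ hΛ)
  obtain ⟨u, ⟨B, hB⟩, c, hc, hu⟩ := hsol.exists_supersolution (by norm_num) hΛ hb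
  obtain ⟨C, hC, μ, hμ, hμ1, hcase⟩ :=
    HolderStability.prod_iterate_decay_or_growth_of_supersolution f.continuous hinv hz hdense
      hcompact hsplit.continuousOn_rate hsplit.rate_pos hB hc hu
  have hr0 : r ≠ 0 := by lia
  refine hsplit.isHyperbolic_of_isContracted (hcase.imp ?_ ?_) hθ hK
  · exact HolderStability.isContracted_span_of_prod_le hr0 hsplit.norm_field hsplit.rate_pos
      hsplit.mfderiv_field hC hμ hμ1 hΛ
  · exact HolderStability.isContracted_symm_span_of_one_le_prod hr0 hsplit.norm_field
      hsplit.rate_pos hsplit.mfderiv_field hC hμ hμ1 hinv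

theorem corollary1p3
    {E : Type*} [NormedAddCommGroup E] [NormedSpace ℝ E] [FiniteDimensional ℝ E]
    {M : Type*} [EMetricSpace M] [SecondCountableTopology M] [ChartedSpace E M]
    (r : ℕ) (hr : 2 ≤ r)
    [IsManifold 𝓘(ℝ, E) r M] [IsManifold 𝓘(ℝ, E) 1 M]
    [RiemannianBundle (fun x : M => TangentSpace 𝓘(ℝ, E) x)]
    [IsContinuousRiemannianBundle E (fun x : M => TangentSpace 𝓘(ℝ, E) x)]
    [IsRiemannianManifold 𝓘(ℝ, E) M]
    (f : M ≃ₘ^r⟮𝓘(ℝ, E), 𝓘(ℝ, E)⟯ M)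
    (Λ : Set M) (hcompact : IsCompact Λ) (hinv : f '' Λ = Λ)
    (htrans : HolderStability.IsTransitive f Λ)
    (Es Ec Eu : ∀ x : M, Submodule ℝ (TangentSpace 𝓘(ℝ, E) x))
    (hph : HolderStability.IsPartiallyHyperbolic f Λ Es Ec Eu)
    (hdim : ∀ x ∈ Λ, Module.finrank ℝ (Ec x) = 1)
    (X : ∀ x : M, TangentSpace 𝓘(ℝ, E) x)
    (horient : HolderStability.IsOrientation Λ Ec X)
    (hpres : HolderStability.PreservesOrientation f Λ X)
    (α : ℝ) (hα : 1 / 2 < α)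
    (hstable : HolderStability.IsHolderStable f Λ α) :
    HolderStability.IsHyperbolic f Λ := by
  obtain ⟨a, hsplit⟩ := hph.exists_isCentreSplitting hdim horient hpres
  exact corollary1p3_general hr hcompact hinv htrans hsplit hα hstable.isHolderSemistable
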